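/- **Proposition 2.4.** Let $n\ge 1$ and $\mu\in\mathbb R$. There is a constant $C=C(n,\mu)>0$ such that the following holds for all $s>0$, all $v_1\in L^1(\mathbb R^n)\cap L^2(\mathbb R^n)$ and all $t\ge s$. Let $v$ be the energy solution, i.e. the weak solution in $\mathcal C([s,\infty),H^1)\cap\mathcal C^1([s,\infty),L^2)$, of the linear Euler–Poisson–Darboux Cauchy problem $$v_{tt}-\Delta v+\frac{\mu}{t}\,v_t=0,\quad t\ge s,\ x\in\mathbb R^n,\qquad v(s,x)=0,\quad v_t(s,x)=v_1(x).$$ Then $$\|(\nabla v,v_t)(t,\cdot)\|_{L^2}\le\begin{cases} C\,s\,t^{-\frac n2-1}\big(\|v_1\|_{L^1}+s^{\frac n2}\|v_1\|_{L^2}\big) & \text{if }\mu>n+2,\\[2pt] C\,s\,t^{-\frac\mu2}\,(1+\log(t/s))\,\big(\|v_1\|_{L^1}+s^{\frac n2}\|v_1\|_{L^2}\big) & \text{if }\mu=n+2,\\[2pt] C\,t^{-\frac\mu2}\big(s^{\frac{\mu-n}2}\|v_1\|_{L^1}+s^{\frac\mu2}\|v_1\|_{L^2}\big) & \text{if }-n<\mu<n+2,\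 \mu\ne1,\\[2pt] C\,t^{-\frac12}\big(s^{-\frac{n-1}2}(1+\log(t/s))\|v_1\|_{L^1}+s^{\frac\mu2}\|v_1\|_{L^2}\big) & \text{if }\mu=1. \end{cases}$$ -/

import Mathlib

open MeasureTheory Set
open scoped ContDiff

/-- The space `L²(ℝⁿ; F)` of square integrable functions with values in `F`. -/
abbrev L2 (n : ℕ) (F : Type*) [NormedAddCommGroup F] : Type _ :=
  Lp F 2 (volume : Measure (EuclideanSpace ℝ (Fin n)))

/-- The `i`-th partial derivative of a function on `ℝⁿ`. -/
noncomputable def partialDeriv {n : ℕ} (i : Fin n) (ψ : EuclideanSpace ℝ (Fin n) → ℝ)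
    (x : EuclideanSpace ℝ (Fin n)) : ℝ :=
  fderiv ℝ ψ x (EuclideanSpace.single i 1)

/-- Test functions on `ℝⁿ`: the smooth functions with compact support. -/
def IsTestFunction {n : ℕ} (ψ : EuclideanSpace ℝ (Fin n) → ℝ) : Prop :=
  ContDiff ℝ ∞ ψ ∧ HasCompactSupport ψ

/-- `g ∈ L²` is the weak gradient of `u ∈ L²`: `∫ u ∂ᵢψ dx = - ∫ gᵢ ψ dx` for every test function
`ψ` and every `i`. Thus `u` belongs to `H¹(ℝⁿ)` exactly if it has a weak gradient, which is then
unique. -/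
def IsWeakGradient {n : ℕ} {𝕜 : Type*} [RCLike 𝕜]
    (u : L2 n 𝕜) (g : L2 n (EuclideanSpace 𝕜 (Fin n))) : Prop :=
  ∀ ψ : EuclideanSpace ℝ (Fin n) → ℝ, IsTestFunction ψ → ∀ i : Fin n,
    ∫ x, partialDeriv i ψ x • u x = - ∫ x, ψ x • g x i

/-- `v`, with spatial gradient `Dv` and time derivative `vt`, is an energy solution, i.e. a weak
solution in `C([s,∞), H¹) ∩ C¹([s,∞), L²)`, of the Cauchy problem
`v_tt - Δv + (μ/t) v_t = 0` for `t ≥ s`, `v(s,·) = 0`, `v_t(s,·) = v₁`.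
The values of `v`, `Dv`, `vt` at times before `s` play no role. -/
structure IsEnergySolution {n : ℕ} {𝕜 : Type*} [RCLike 𝕜] (μ s : ℝ)
    (v₁ : EuclideanSpace ℝ (Fin n) → 𝕜)
    (v : ℝ → L2 n 𝕜) (Dv : ℝ → L2 n (EuclideanSpace 𝕜 (Fin n))) (vt : ℝ → L2 n 𝕜) : Prop where
  /-- `v(t,·) ∈ H¹`, with weak gradient `Dv(t,·)`. -/
  weakGradient : ∀ t ∈ Ici s, IsWeakGradient (v t) (Dv t)
  /-- `v ∈ C([s,∞), H¹)`: continuity of `v` in `L²`. -/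
  continuousOn : ContinuousOn v (Ici s)
  /-- `v ∈ C([s,∞), H¹)`: continuity of the gradient in `L²`. -/
  continuousOn_gradient : ContinuousOn Dv (Ici s)
  /-- `vt` is the derivative of the `L²`-valued map `v` (one-sided at `s`). -/
  hasDerivWithinAt : ∀ t ∈ Ici s, HasDerivWithinAt v (vt t) (Ici s) t
  /-- `v ∈ C¹([s,∞), L²)`. -/
  continuousOn_timeDeriv : ContinuousOn vt (Ici s)
  /-- The equation, tested in space:
  `d/dt ∫ v_t ψ dx = - ∫ ∇v · ∇ψ dx - (μ/t) ∫ v_t ψ dx` for `t > s`. -/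
  equation : ∀ ψ : EuclideanSpace ℝ (Fin n) → ℝ, IsTestFunction ψ → ∀ t ∈ Ioi s,
    HasDerivAt (fun τ : ℝ => ∫ x, ψ x • vt τ x)
      (-(∫ x, ∑ i, partialDeriv i ψ x • Dv t x i) - (μ / t) • ∫ x, ψ x • vt t x) t
  /-- First initial condition, `v(s,·) = 0`. -/
  initial : v s = 0
  /-- Second initial condition, `v_t(s,·) = v₁`. -/
  initial_timeDeriv : vt s =ᵐ[volume] v₁

/-! After a Fourier transform in space the equation reads x'' + (2π|ξ|)² x + (μ/t) x' = 0. It is not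
solved by special functions. Frequency bands a < 2π|ξ| ≤ b are treated as a whole by energy methods:
the part of the solution in a band is an L²-valued curve x with x'' + K²x + (μ/t)x' = 0, K bounded,
and only the scalars in `EnergyQuantities` enter.

There are two regimes. While bT ≤ 2, the term K²x is a perturbation. Without it, t x' + (μ-1)x is
constant and x' is proportional to t^(-μ). This suggests, and a Grönwall argument proves, that the
energy at T is at most C (s/T)^(2 min(μ,1)) |x'(s)|², with an extra factor (1 + log(T/s))² if μ = 1
(`energy_le_of_mul_le_two`). Once at ≥ 1, the solution oscillates, kinetic and potential energy
balance on average, and the energy decays like t^(-μ) (`energy_le_of_one_le`).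

For fixed t, cut the frequencies at 1/t, 2/t, 4/t, …, 2^J/t with 2^J/t ≥ 1/s. The lowest band stays
in the first regime up to time t; the band starting at 2^j/t changes regime at T = t/2^j; everything
above 2^J/t oscillates from time s on and contributes (s/t)^μ ‖v₁‖₂². In the other bands the
transform of v₁ is bounded by ‖v₁‖₁ and the volume by C(2^j/t)^n, so they contribute at most a
multiple of ‖v₁‖₁² (s/t)^(2 min(μ,1)) t^(-n) Σ 2^(j(n + 2 min(μ,1) - μ)), up to the logarithm for μ
= 1 (`exists_energy_le`). The cases of the theorem reflect the sign of the exponent: negative for μ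
> n+2, where the sum is bounded; zero for μ = n+2, where it counts about log(t/s) terms; positive
for -n < μ < n+2, where the last term dominates.

The equation is given only against test functions. Integrated in time it becomes an identity of
tempered distributions; its Fourier transform, cut off to a band, is an integral equation in L²,
hence a genuine differential equation (`energyQuantities_band`). -/

/-- A form of Grönwall's inequality: if `f' ≤ G' f` then `f b ≤ exp (G b - G a) f a`. -/
theorem le_exp_mul_of_deriv_le {f f' G G' : ℝ → ℝ} {a b : ℝ} (hab : a ≤ b)
    (hf : ∀ t ∈ Icc a b, HasDerivWithinAt f (f' t) (Ici a) t)
    (hG : ∀ t ∈ Icc a b, HasDerivWithinAt G (G' t) (Ici a) t)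
    (h : ∀ t ∈ Icc a b, f' t ≤ G' t * f t) : f b ≤ Real.exp (G b - G a) * f a := by
  have hd : ∀ t ∈ Icc a b, HasDerivWithinAt (fun t => Real.exp (-G t) * f t)
      (Real.exp (-G t) * (-G' t) * f t + Real.exp (-G t) * f' t) (Ici a) t :=
    fun t ht => ((hG t ht).neg.exp).mul (hf t ht)
  have hanti : AntitoneOn (fun t => Real.exp (-G t) * f t) (Icc a b) := by
    apply antitoneOn_of_deriv_nonpos (convex_Icc a b)
    · exact fun t ht => ((hd t ht).mono Icc_subset_Ici_self).continuousWithinAt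
    · intro t ht
      rw [interior_Icc] at ht
      exact ((hd t (Ioo_subset_Icc_self ht)).hasDerivAt
        (Ici_mem_nhds ht.1)).differentiableAt.differentiableWithinAt
    · intro t ht
      rw [interior_Icc] at ht
      rw [((hd t (Ioo_subset_Icc_self ht)).hasDerivAt (Ici_mem_nhds ht.1)).deriv]
      have := h t (Ioo_subset_Icc_self ht)
      have hp := Real.exp_pos (-G t)
      nlinarith
  have := hanti (left_mem_Icc.2 hab) (right_mem_Icc.2 hab) hab
  simp only at this
  have hp := Real.exp_pos (G b)
  calc f b = Real.exp (G b) * (Real.exp (-G b) * f b) := by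
        rw [← mul_assoc, ← Real.exp_add]; simp
    _ ≤ Real.exp (G b) * (Real.exp (-G a) * f a) := by gcongr
    _ = _ := by rw [← mul_assoc, ← Real.exp_add]; ring_nf

/-! ### Energy estimates for x'' + K²x + (μ/t)x' = 0 -/

/-- The quadratic quantities `P = |x|²`, `Q = |Kx|²`, `R = |x'|²`, `S = ⟨x, x'⟩` and `D = Q'` of a
solution of `x'' + K² x + (μ / t) x' = 0` with `‖K‖ ≤ b` and `x(s) = 0`. -/
structure EnergyQuantities (μ s b : ℝ) (P Q R S D : ℝ → ℝ) : Prop where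
  hasDeriv_P : ∀ t ∈ Ici s, HasDerivWithinAt P (2 * S t) (Ici s) t
  hasDeriv_Q : ∀ t ∈ Ici s, HasDerivWithinAt Q (D t) (Ici s) t
  hasDeriv_R : ∀ t ∈ Ici s, HasDerivWithinAt R (-D t - 2 * (μ / t) * R t) (Ici s) t
  hasDeriv_S : ∀ t ∈ Ici s, HasDerivWithinAt S (R t - Q t - μ / t * S t) (Ici s) t
  P_nonneg : ∀ t ∈ Ici s, 0 ≤ P t
  Q_nonneg : ∀ t ∈ Ici s, 0 ≤ Q t
  R_nonneg : ∀ t ∈ Ici s, 0 ≤ R t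
  S_sq_le : ∀ t ∈ Ici s, S t ^ 2 ≤ P t * R t
  D_sq_le : ∀ t ∈ Ici s, D t ^ 2 ≤ 4 * b ^ 4 * (P t * R t)
  Q_le : ∀ t ∈ Ici s, Q t ≤ b ^ 2 * P t
  P_init : P s = 0
  Q_init : Q s = 0
  S_init : S s = 0

/-- The inequality of arithmetic and geometric means for P and c²R. -/
theorem two_mul_abs_le_add_of_sq_le {P R S c : ℝ} (hP : 0 ≤ P) (hR : 0 ≤ R)
    (h : S ^ 2 ≤ P * R) : 2 * c * |S| ≤ P + c ^ 2 * R := by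
  have h1 : (2 * c * |S|) ^ 2 ≤ (P + c ^ 2 * R) ^ 2 := by
    have : (2 * c * |S|) ^ 2 = 4 * c ^ 2 * S ^ 2 := by rw [mul_pow, mul_pow, sq_abs]; ring
    rw [this]
    nlinarith [sq_nonneg (P - c ^ 2 * R), sq_nonneg c]
  exact le_of_sq_le_sq h1 (by positivity)

namespace EnergyQuantities

variable {μ s b : ℝ} {P Q R S D : ℝ → ℝ}

/-- Cauchy–Schwarz, then the arithmetic-geometric mean inequality for P and t²R. It controls the
perturbation K²x in the non-oscillating regime. -/
theorem abs_D_le (h : EnergyQuantities μ s b P Q R S D) {t : ℝ} (ht : t ∈ Ici s) :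
    t * |D t| ≤ b ^ 2 * (P t + t ^ 2 * R t) := by
  have hP := h.P_nonneg t ht
  have hR := h.R_nonneg t ht
  have h1 : (t * |D t|) ^ 2 ≤ (b ^ 2 * (P t + t ^ 2 * R t)) ^ 2 := by
    have := h.D_sq_le t ht
    rw [mul_pow, sq_abs]
    calc t ^ 2 * D t ^ 2 ≤ t ^ 2 * (4 * b ^ 4 * (P t * R t)) := by gcongr
      _ = b ^ 4 * (4 * P t * (t ^ 2 * R t)) := by ring
      _ ≤ b ^ 4 * (P t + t ^ 2 * R t) ^ 2 := by
          gcongr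
          nlinarith [sq_nonneg (P t - t ^ 2 * R t)]
      _ = _ := by ring
  exact le_of_sq_le_sq h1 (by positivity)

/-- The form is |c x' + d x|² in terms of the scalars; its positivity needs only S² ≤ PR. All
completions of squares below are instances. -/
theorem quadratic_nonneg (h : EnergyQuantities μ s b P Q R S D) {t : ℝ} (ht : t ∈ Ici s) (c d : ℝ) :
    0 ≤ c ^ 2 * R t + 2 * (c * d) * S t + d ^ 2 * P t := by
  have hP := h.P_nonneg t ht
  have hR := h.R_nonneg t ht
  rcases eq_or_ne d 0 with rfl | hd
  · simp; positivity
  have h2 := two_mul_abs_le_add_of_sq_le (P := d ^ 2 * P t) (R := R t) (S := |d| * S t)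
    (by positivity) hR (by rw [mul_pow, sq_abs]; nlinarith [h.S_sq_le t ht, sq_nonneg d]) (c := |c|)
  have h3 : -(2 * |c| * |(|d| * S t)|) ≤ 2 * (c * d) * S t := by
    have : 2 * |c| * |(|d| * S t)| = |2 * (c * d) * S t| := by
      simp only [abs_mul, abs_abs]; norm_num; ring
    rw [this]; exact neg_abs_le _
  rw [sq_abs] at h2
  linarith

/-- Decay of the energy in the oscillating regime `a t ≥ 1`. -/
theorem energy_le_of_one_le (μ : ℝ) : ∃ C : ℝ, 0 < C ∧ ∀ {s b a : ℝ} {P Q R S D : ℝ → ℝ},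
    0 < s → 0 < a → EnergyQuantities μ s b P Q R S D → (∀ t ∈ Ici s, a ^ 2 * P t ≤ Q t) →
    ∀ t₀ t : ℝ, s ≤ t₀ → t₀ ≤ t → 1 ≤ a * t₀ →
      Q t + R t ≤ C * (t₀ / t) ^ μ * (Q t₀ + R t₀) := by
  -- With this c, twice the corrected energy minus Q + R is Q + |x' + (μ/τ)x|², hence nonnegative.
  set c : ℝ := μ ^ 2 / 2 with hc
  have hc0 : 0 ≤ c := by positivity
  set M : ℝ := |μ| + c * |μ - 2| + 2 * c with hM
  have hM0 : 0 ≤ M := by positivity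
  refine ⟨2 * Real.exp (2 * M) * (1 + |μ| + c), by positivity, ?_⟩
  intro s b a P Q R S D hs ha h hPQ t₀ t hst₀ ht₀t hat₀
  have ht₀ : 0 < t₀ := hs.trans_le hst₀
  have ht : 0 < t := ht₀.trans_le ht₀t
  have hE : ∀ τ ∈ Icc t₀ t, 0 < τ ∧ τ ∈ Ici s ∧ 1 ≤ a * τ ∧ |S τ| ≤ (Q τ + R τ) / a ∧
      P τ / τ ≤ (Q τ + R τ) / a := by
    intro τ hτ
    have hτ0 : 0 < τ := ht₀.trans_le hτ.1
    have hτs : τ ∈ Ici s := hst₀.trans hτ.1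
    have hP := h.P_nonneg τ hτs
    have hQ := h.Q_nonneg τ hτs
    have hR := h.R_nonneg τ hτs
    have haτ : 1 ≤ a * τ := hat₀.trans (by gcongr; exact hτ.1)
    refine ⟨hτ0, hτs, haτ, ?_, ?_⟩
    · rw [le_div_iff₀ ha]
      have := two_mul_abs_le_add_of_sq_le (P := R τ) (R := P τ) (c := a) hR hP
        (by rw [mul_comm]; exact h.S_sq_le τ hτs)
      have h2 := hPQ τ hτs
      have : 0 ≤ |S τ| * a := by positivity
      linarith
    · rw [div_le_div_iff₀ hτ0 ha]
      have h2 := hPQ τ hτs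
      have h3 : a * P τ * 1 ≤ a * P τ * (a * τ) := by gcongr
      nlinarith
  -- The derivative of τ^μ(Q + R) is μτ^(μ-1)(Q - R), which is not small. The correction μS/τ
  -- cancels it and leaves errors of relative size 1/(aτ²).
  set F : ℝ → ℝ := fun τ => τ ^ μ * (Q τ + R τ + μ * S τ / τ + c * P τ / τ ^ 2) with hF
  have hFlow : ∀ τ ∈ Icc t₀ t, τ ^ μ * (Q τ + R τ) ≤ 2 * F τ := by
    intro τ hτ
    obtain ⟨hτ0, hτs, -, -, -⟩ := hE τ hτ
    have hq := h.quadratic_nonneg hτs 1 (μ / τ)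
    have hQ := h.Q_nonneg τ hτs
    have : Q τ + R τ ≤ 2 * (Q τ + R τ + μ * S τ / τ + c * P τ / τ ^ 2) := by
      have e : 2 * (Q τ + R τ + μ * S τ / τ + c * P τ / τ ^ 2) - (Q τ + R τ) =
          Q τ + (1 ^ 2 * R τ + 2 * (1 * (μ / τ)) * S τ + (μ / τ) ^ 2 * P τ) := by
        rw [hc]; field_simp; ring
      linarith
    have hp : 0 < τ ^ μ := Real.rpow_pos_of_pos hτ0 μ
    simp only [hF]
    nlinarith
  have hFd : ∀ τ ∈ Icc t₀ t, HasDerivWithinAt F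
      (τ ^ μ * ((-μ * S τ + c * (μ - 2) * (P τ / τ) + 2 * c * S τ) / τ ^ 2)) (Ici t₀) τ := by
    intro τ hτ
    obtain ⟨hτ0, hτs, -, -, -⟩ := hE τ hτ
    have hsub : Ici t₀ ⊆ Ici s := Ici_subset_Ici.2 hst₀
    have dP := (h.hasDeriv_P τ hτs).mono hsub
    have dQ := (h.hasDeriv_Q τ hτs).mono hsub
    have dR := (h.hasDeriv_R τ hτs).mono hsub
    have dS := (h.hasDeriv_S τ hτs).mono hsub
    have did := hasDerivWithinAt_id τ (Ici t₀)
    have dpow := (Real.hasDerivAt_rpow_const (p := μ) (Or.inl hτ0.ne')).hasDerivWithinAt (s := Ici t₀)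
    have := dpow.mul (((dQ.add dR).add ((dS.const_mul μ).div did hτ0.ne')).add
      ((dP.const_mul c).div (did.pow 2) (pow_ne_zero 2 hτ0.ne')))
    refine this.congr_deriv ?_
    simp only [Pi.add_apply, Pi.pow_apply, Pi.div_apply, id]
    rw [Real.rpow_sub_one hτ0.ne']
    field_simp
    ring
  -- The growth rate 2M/(aτ²) has integral at most 2M/(at₀) ≤ 2M.
  have hgr := le_exp_mul_of_deriv_le (f := F) (G := fun τ => -(2 * M / a) * τ⁻¹)
    (G' := fun τ => 2 * M / a * (τ ^ 2)⁻¹) ht₀t hFd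
    (fun τ hτ => by
      have := ((hasDerivAt_inv (hE τ hτ).1.ne').const_mul (-(2 * M / a))).hasDerivWithinAt
        (s := Ici t₀)
      exact this.congr_deriv (by ring))
    (fun τ hτ => by
      obtain ⟨hτ0, hτs, haτ, h1, h2⟩ := hE τ hτ
      have hp : 0 < τ ^ μ := Real.rpow_pos_of_pos hτ0 μ
      have hP := h.P_nonneg τ hτs
      have h3 : -μ * S τ + c * (μ - 2) * (P τ / τ) + 2 * c * S τ ≤ M * ((Q τ + R τ) / a) := by
        have e1 : -μ * S τ ≤ |μ| * ((Q τ + R τ) / a) := by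
          calc -μ * S τ ≤ |-μ * S τ| := le_abs_self _
            _ = |μ| * |S τ| := by rw [abs_mul, abs_neg]
            _ ≤ _ := by gcongr
        have e2 : c * (μ - 2) * (P τ / τ) ≤ c * |μ - 2| * ((Q τ + R τ) / a) := by
          calc c * (μ - 2) * (P τ / τ) ≤ c * |μ - 2| * (P τ / τ) := by
                have : 0 ≤ P τ / τ := by positivity
                gcongr; exact le_abs_self _
            _ ≤ _ := by gcongr
        have e3 : 2 * c * S τ ≤ 2 * c * ((Q τ + R τ) / a) := by
          gcongr; exact (le_abs_self _).trans h1
        rw [hM]; linarith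
      calc τ ^ μ * ((-μ * S τ + c * (μ - 2) * (P τ / τ) + 2 * c * S τ) / τ ^ 2)
          ≤ τ ^ μ * ((M * ((Q τ + R τ) / a)) / τ ^ 2) := by gcongr
        _ = M / a * (τ ^ 2)⁻¹ * (τ ^ μ * (Q τ + R τ)) := by field_simp
        _ ≤ M / a * (τ ^ 2)⁻¹ * (2 * F τ) := by
            have := hFlow τ hτ
            gcongr
        _ = _ := by ring)
  have hup : F t₀ ≤ t₀ ^ μ * ((1 + |μ| + c) * (Q t₀ + R t₀)) := by
    obtain ⟨hτ0, hτs, haτ, h1, h2⟩ := hE t₀ (left_mem_Icc.2 ht₀t)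
    have hp : 0 < t₀ ^ μ := Real.rpow_pos_of_pos hτ0 μ
    have hE0 : 0 ≤ Q t₀ + R t₀ := add_nonneg (h.Q_nonneg _ hτs) (h.R_nonneg _ hτs)
    have hle : (Q t₀ + R t₀) / a / t₀ ≤ Q t₀ + R t₀ := by
      rw [div_div]; exact div_le_self hE0 haτ
    have e1 : μ * S t₀ / t₀ ≤ |μ| * (Q t₀ + R t₀) := by
      calc μ * S t₀ / t₀ ≤ |μ * S t₀| / t₀ := by gcongr; exact le_abs_self _
        _ = |μ| * (|S t₀| / t₀) := by rw [abs_mul]; ring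
        _ ≤ |μ| * ((Q t₀ + R t₀) / a / t₀) := by gcongr
        _ ≤ _ := by gcongr
    have e2 : c * P t₀ / t₀ ^ 2 ≤ c * (Q t₀ + R t₀) := by
      calc c * P t₀ / t₀ ^ 2 = c * (P t₀ / t₀ / t₀) := by field_simp
        _ ≤ c * ((Q t₀ + R t₀) / a / t₀) := by gcongr
        _ ≤ _ := by gcongr
    simp only [hF]
    gcongr
    linarith
  have hexp : Real.exp (-(2 * M / a) * t⁻¹ - -(2 * M / a) * t₀⁻¹) ≤ Real.exp (2 * M) := by
    apply Real.exp_le_exp.2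
    have h1 : 0 ≤ 2 * M / a * t⁻¹ := by positivity
    have h2 : 2 * M / a * t₀⁻¹ ≤ 2 * M := by
      rw [← div_eq_mul_inv, div_div]; exact div_le_self (by positivity) hat₀
    linarith
  have hE0 : 0 ≤ Q t₀ + R t₀ := add_nonneg (h.Q_nonneg _ hst₀) (h.R_nonneg _ hst₀)
  have hp : 0 < t ^ μ := Real.rpow_pos_of_pos ht μ
  have hp0 : 0 < t₀ ^ μ := Real.rpow_pos_of_pos ht₀ μ
  have hfin : t ^ μ * (Q t + R t) ≤
      t ^ μ * (2 * Real.exp (2 * M) * (1 + |μ| + c) * (t₀ / t) ^ μ * (Q t₀ + R t₀)) := by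
    calc t ^ μ * (Q t + R t) ≤ 2 * F t := hFlow t (right_mem_Icc.2 ht₀t)
      _ ≤ 2 * (Real.exp (-(2 * M / a) * t⁻¹ - -(2 * M / a) * t₀⁻¹) * F t₀) := by gcongr
      _ ≤ 2 * (Real.exp (-(2 * M / a) * t⁻¹ - -(2 * M / a) * t₀⁻¹) *
            (t₀ ^ μ * ((1 + |μ| + c) * (Q t₀ + R t₀)))) := by gcongr
      _ ≤ 2 * (Real.exp (2 * M) * (t₀ ^ μ * ((1 + |μ| + c) * (Q t₀ + R t₀)))) := by gcongr
      _ = _ := by rw [Real.div_rpow ht₀.le ht.le]; field_simp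
  exact le_of_mul_le_mul_left hfin hp

/-- The energy before the oscillating regime, for `μ ≠ 1`; here `e` is the exponent of a weight. -/
theorem energy_le_of_mul_le_two_aux {μ e : ℝ}
    (he : (e = 0 ∧ 1 < μ) ∨ (e = 2 * (μ - 1) ∧ μ < 1)) :
    ∃ C : ℝ, 0 < C ∧ ∀ {s b : ℝ} {P Q R S D : ℝ → ℝ},
    0 < s → 0 ≤ b → EnergyQuantities μ s b P Q R S D →
    ∀ T : ℝ, s ≤ T → b * T ≤ 2 → Q T + R T ≤ C * ((s / T) ^ 2 * (s / T) ^ e) * R s := by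
  obtain ⟨m, rfl⟩ : ∃ m, μ = m + 1 := ⟨μ - 1, by ring⟩
  rw [add_sub_cancel_right] at he
  have hm : m ≠ 0 := by rintro rfl; rcases he with ⟨_, h⟩ | ⟨_, h⟩ <;> simp at h
  have hm2 : 0 < m ^ 2 := by positivity
  set M : ℝ := 2 * (2 / m ^ 2 + 1) + 2 * |m| * (2 / m ^ 2) with hM
  have hM0 : 0 < M := by positivity
  refine ⟨Real.exp (2 * M) * (8 / m ^ 2 + 1) * 2, by positivity, ?_⟩
  intro s b P Q R S D hs hb h T hsT hbT
  have hT : 0 < T := hs.trans_le hsT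
  -- Ψ = |τx'|² + |τx' + mx|². For K = 0 the second term is constant and the first is proportional
  -- to τ^(-2m); the weight τ^e compensates the growth if m < 0.
  set Ψ : ℝ → ℝ := fun τ => 2 * (τ ^ 2 * R τ) + 2 * m * (τ * S τ) + m ^ 2 * P τ with hΨ
  have hco : ∀ τ ∈ Ici s, τ ^ 2 * R τ ≤ Ψ τ ∧ m ^ 2 * P τ ≤ 2 * Ψ τ := by
    intro τ hτ
    have h1 := h.quadratic_nonneg hτ τ m
    have h2 := h.quadratic_nonneg hτ (2 * τ) m
    simp only [hΨ]
    constructor <;> nlinarith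
  have hP' : ∀ τ ∈ Ici s, P τ ≤ 2 / m ^ 2 * Ψ τ := by
    intro τ hτ
    rw [div_mul_eq_mul_div, le_div_iff₀ hm2]
    linarith [(hco τ hτ).2]
  have hd : ∀ τ ∈ Icc s T, HasDerivWithinAt (fun τ => τ ^ e * Ψ τ)
      (τ ^ e * (e * Ψ τ / τ + (-2 * m * τ * R τ - 2 * τ ^ 2 * D τ - 2 * m * τ * Q τ)))
      (Ici s) τ := by
    intro τ hτ
    have hτ0 : 0 < τ := hs.trans_le hτ.1
    have dP := h.hasDeriv_P τ hτ.1
    have dR := h.hasDeriv_R τ hτ.1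
    have dS := h.hasDeriv_S τ hτ.1
    have did := hasDerivWithinAt_id τ (Ici s)
    have dpow := (Real.hasDerivAt_rpow_const (p := e) (Or.inl hτ0.ne')).hasDerivWithinAt (s := Ici s)
    have := dpow.mul ((((did.pow 2).mul dR).const_mul 2).add ((did.mul dS).const_mul (2 * m))
      |>.add (dP.const_mul (m ^ 2)))
    refine this.congr_deriv ?_
    simp only [Pi.add_apply, Pi.mul_apply, Pi.pow_apply, id]
    rw [Real.rpow_sub_one hτ0.ne']
    simp only [hΨ]
    field_simp
    ring
  have hgr := le_exp_mul_of_deriv_le (f := fun τ => τ ^ e * Ψ τ) (G := fun τ => b ^ 2 * M * (τ ^ 2 / 2))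
    (G' := fun τ => b ^ 2 * M * τ) hsT hd
    (fun τ _ => by
      have := ((((hasDerivAt_id τ).pow 2).div_const 2).const_mul (b ^ 2 * M)).hasDerivWithinAt
        (s := Ici s)
      refine this.congr_deriv ?_
      simp)
    (fun τ hτ => by
      have hτ0 : 0 < τ := hs.trans_le hτ.1
      have hp : 0 < τ ^ e := Real.rpow_pos_of_pos hτ0 e
      have hP := h.P_nonneg τ hτ.1
      have hR := h.R_nonneg τ hτ.1
      have hQ := h.Q_nonneg τ hτ.1
      have hQP := h.Q_le τ hτ.1
      obtain ⟨c1, c2⟩ := hco τ hτ.1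
      have c3 := hP' τ hτ.1
      have hΨ0 : 0 ≤ Ψ τ := le_trans (by positivity) c1
      have hD : -2 * τ ^ 2 * D τ ≤ 2 * τ * (b ^ 2 * ((2 / m ^ 2 + 1) * Ψ τ)) := by
        calc -2 * τ ^ 2 * D τ ≤ |-2 * τ ^ 2 * D τ| := le_abs_self _
          _ = 2 * τ * (τ * |D τ|) := by
            rw [abs_mul, abs_mul, abs_neg, abs_two, abs_of_nonneg (sq_nonneg τ)]; ring
          _ ≤ 2 * τ * (b ^ 2 * (P τ + τ ^ 2 * R τ)) := by
            exact mul_le_mul_of_nonneg_left (h.abs_D_le hτ.1) (by positivity)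
          _ ≤ _ := by gcongr; linarith
      have key : e * Ψ τ / τ + (-2 * m * τ * R τ - 2 * τ ^ 2 * D τ - 2 * m * τ * Q τ) ≤
          b ^ 2 * M * τ * Ψ τ := by
        have hQ2 : |m| * τ * Q τ ≤ |m| * τ * (b ^ 2 * (2 / m ^ 2 * Ψ τ)) := by
          gcongr
          exact hQP.trans (by gcongr)
        have hMe : b ^ 2 * M * τ * Ψ τ = 2 * τ * (b ^ 2 * ((2 / m ^ 2 + 1) * Ψ τ)) +
            2 * (|m| * τ * (b ^ 2 * (2 / m ^ 2 * Ψ τ))) := by rw [hM]; ring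
        rcases he with ⟨rfl, hmp⟩ | ⟨rfl, hmn⟩
        · have hm' : 0 < m := by linarith
          have : 0 ≤ m * τ * R τ := by positivity
          have : 0 ≤ m * τ * Q τ := by positivity
          have : 0 ≤ |m| * τ * (b ^ 2 * (2 / m ^ 2 * Ψ τ)) := by positivity
          rw [hMe, zero_mul, zero_div]
          linarith
        · have hm' : 0 < -m := by linarith
          rw [abs_of_neg (by linarith : m < 0)] at hQ2 hMe
          have hq := h.quadratic_nonneg hτ.1 τ m
          -- The left side is (2m/τ)|τx' + mx|², and m < 0.
          have hle : 2 * m * Ψ τ / τ - 2 * m * τ * R τ ≤ 0 := by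
            have : 2 * m * Ψ τ / τ - 2 * m * τ * R τ =
              -(2 * (-m) * (τ ^ 2 * R τ + 2 * (τ * m) * S τ + m ^ 2 * P τ) / τ) := by
              simp only [hΨ]; field_simp; ring
            rw [this]
            exact neg_nonpos.2 (by positivity)
          linarith
      calc _ ≤ τ ^ e * (b ^ 2 * M * τ * Ψ τ) := by gcongr
        _ = _ := by ring)
  have hR0 := h.R_nonneg s self_mem_Ici
  have hRT := h.R_nonneg T hsT
  have hPT := h.P_nonneg T hsT
  have hexp : Real.exp (b ^ 2 * M * (T ^ 2 / 2) - b ^ 2 * M * (s ^ 2 / 2)) ≤ Real.exp (2 * M) := by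
    apply Real.exp_le_exp.2
    have h1 : 0 ≤ b ^ 2 * M * (s ^ 2 / 2) := by positivity
    have h2 : b ^ 2 * M * (T ^ 2 / 2) = (b * T) ^ 2 * M / 2 := by ring
    have h3 : (b * T) ^ 2 ≤ 2 ^ 2 := by gcongr
    nlinarith
  have hinit : Ψ s = 2 * (s ^ 2 * R s) := by simp [hΨ, h.S_init, h.P_init]
  -- The potential energy is recovered from P by T²Q ≤ (bT)²P ≤ 4P.
  have hE : T ^ 2 * (Q T + R T) ≤ (8 / m ^ 2 + 1) * Ψ T := by
    have h1 : T ^ 2 * Q T ≤ 4 * P T := by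
      calc T ^ 2 * Q T ≤ T ^ 2 * (b ^ 2 * P T) := by gcongr; exact h.Q_le T hsT
        _ = (b * T) ^ 2 * P T := by ring
        _ ≤ 2 ^ 2 * P T := by gcongr
        _ = _ := by ring
    have h2 := (hco T hsT).1
    have h3 := hP' T hsT
    have : 8 / m ^ 2 = 4 * (2 / m ^ 2) := by ring
    rw [this]
    linarith
  have hpT : 0 < T ^ e := Real.rpow_pos_of_pos hT e
  have hps : 0 < s ^ e := Real.rpow_pos_of_pos hs e
  have hfin : T ^ e * (T ^ 2 * (Q T + R T)) ≤ T ^ e * (T ^ 2 *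
      (Real.exp (2 * M) * (8 / m ^ 2 + 1) * 2 * ((s / T) ^ 2 * (s / T) ^ e) * R s)) := by
    calc T ^ e * (T ^ 2 * (Q T + R T)) ≤ T ^ e * ((8 / m ^ 2 + 1) * Ψ T) := by gcongr
      _ = (8 / m ^ 2 + 1) * (T ^ e * Ψ T) := by ring
      _ ≤ (8 / m ^ 2 + 1) * (Real.exp (2 * M) * (s ^ e * Ψ s)) := by
          have : 0 ≤ s ^ e * Ψ s := by rw [hinit]; positivity
          have h1 : s ^ e * Ψ s * Real.exp (b ^ 2 * M * (T ^ 2 / 2) - b ^ 2 * M * (s ^ 2 / 2)) ≤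
            s ^ e * Ψ s * Real.exp (2 * M) := by gcongr
          exact mul_le_mul_of_nonneg_left (hgr.trans (by linarith)) (by positivity)
      _ = _ := by rw [hinit, Real.div_rpow hs.le hT.le]; field_simp
  exact le_of_mul_le_mul_left (le_of_mul_le_mul_left hfin hpT) (by positivity)

/-- The energy before the oscillating regime, for `μ = 1`. -/
theorem energy_le_of_mul_le_two_of_eq_one :
    ∃ C : ℝ, 0 < C ∧ ∀ {s b : ℝ} {P Q R S D : ℝ → ℝ},
    0 < s → 0 ≤ b → EnergyQuantities 1 s b P Q R S D →
    ∀ T : ℝ, s ≤ T → b * T ≤ 2 →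
      Q T + R T ≤ C * ((s / T) ^ 2 * (1 + Real.log (T / s)) ^ 2) * R s := by
  refine ⟨Real.exp (4 * 1542) * 4, by positivity, ?_⟩
  intro s b P Q R S D hs hb h T hsT hbT
  have hT : 0 < T := hs.trans_le hsT
  set l : ℝ → ℝ := fun τ => Real.log (T / τ) with hl
  -- Φ = |x + l τx'|² + |τx'|². For K = 0 and μ = 1 both terms are constant: τx' is conserved, and x
  -- + log(T/τ) τx' is the value of x extrapolated to time T.
  set Φ : ℝ → ℝ := fun τ => P τ + 2 * (l τ * (τ * S τ)) + (1 + l τ ^ 2) * (τ ^ 2 * R τ) with hΦ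
  have hco : ∀ τ ∈ Ici s, τ ^ 2 * R τ ≤ Φ τ ∧ P τ ≤ 2 * (1 + l τ ^ 2) * Φ τ := by
    intro τ hτ
    have h1 := h.quadratic_nonneg hτ (l τ * τ) 1
    have h2 := h.quadratic_nonneg hτ (2 * (l τ * τ)) 1
    have hR := h.R_nonneg τ hτ
    have h3 : τ ^ 2 * R τ ≤ Φ τ := by simp only [hΦ]; nlinarith
    refine ⟨h3, ?_⟩
    -- The difference of the two sides is |x + 2l τx'|².
    have h4 : P τ ≤ 2 * (P τ + 2 * (l τ * (τ * S τ)) + l τ ^ 2 * (τ ^ 2 * R τ)) +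
      2 * l τ ^ 2 * (τ ^ 2 * R τ) := by nlinarith
    have h5 : 2 * l τ ^ 2 * (τ ^ 2 * R τ) ≤ 2 * l τ ^ 2 * Φ τ := by gcongr
    have h6 : 0 ≤ τ ^ 2 * R τ := by positivity
    have h7 : P τ + 2 * (l τ * (τ * S τ)) + l τ ^ 2 * (τ ^ 2 * R τ) ≤ Φ τ := by
      simp only [hΦ]; linarith
    linarith
  have hd : ∀ τ ∈ Icc s T, HasDerivWithinAt Φ
      (-2 * l τ * τ * Q τ - (1 + l τ ^ 2) * τ ^ 2 * D τ) (Ici s) τ := by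
    intro τ hτ
    have hτ0 : 0 < τ := hs.trans_le hτ.1
    have dP := h.hasDeriv_P τ hτ.1
    have dR := h.hasDeriv_R τ hτ.1
    have dS := h.hasDeriv_S τ hτ.1
    have did := hasDerivWithinAt_id τ (Ici s)
    have dl : HasDerivWithinAt l (-τ⁻¹) (Ici s) τ := by
      have h1 : HasDerivAt (fun τ => Real.log T - Real.log τ) (-τ⁻¹) τ := by
        simpa using (Real.hasDerivAt_log hτ0.ne').const_sub (Real.log T)
      refine (h1.congr_of_eventuallyEq ?_).hasDerivWithinAt
      filter_upwards [lt_mem_nhds hτ0] with r hr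
      exact Real.log_div hT.ne' hr.ne'
    have := (dP.add ((dl.mul (did.mul dS)).const_mul 2)).add
      (((dl.pow 2).const_add 1).mul ((did.pow 2).mul dR))
    refine this.congr_deriv ?_
    simp only [Pi.mul_apply, Pi.pow_apply, id]
    field_simp
    ring
  have hgr := le_exp_mul_of_deriv_le (f := Φ) (G := fun τ => b ^ 2 * T * 1542 * τ)
    (G' := fun _ => b ^ 2 * T * 1542) hsT hd
    (fun τ _ => by
      simpa using ((hasDerivAt_id τ).const_mul (b ^ 2 * T * 1542)).hasDerivWithinAt (s := Ici s))
    (fun τ hτ => by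
      have hτ0 : 0 < τ := hs.trans_le hτ.1
      have hP := h.P_nonneg τ hτ.1
      have hR := h.R_nonneg τ hτ.1
      have hQ := h.Q_nonneg τ hτ.1
      obtain ⟨c1, c2⟩ := hco τ hτ.1
      have hΦ0 : 0 ≤ Φ τ := le_trans (by positivity) c1
      have hl0 : 0 ≤ l τ := Real.log_nonneg ((one_le_div hτ0).2 hτ.2)
      have hD : -((1 + l τ ^ 2) * τ ^ 2 * D τ) ≤
          (1 + l τ ^ 2) * τ * (b ^ 2 * ((3 + 2 * l τ ^ 2) * Φ τ)) := by
        calc -((1 + l τ ^ 2) * τ ^ 2 * D τ) ≤ |(1 + l τ ^ 2) * τ ^ 2 * D τ| := neg_le_abs _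
          _ = (1 + l τ ^ 2) * τ * (τ * |D τ|) := by
            rw [abs_mul, abs_of_nonneg (by positivity)]; ring
          _ ≤ (1 + l τ ^ 2) * τ * (b ^ 2 * (P τ + τ ^ 2 * R τ)) := by
            exact mul_le_mul_of_nonneg_left (h.abs_D_le hτ.1) (by positivity)
          _ ≤ _ := by gcongr; linarith
      -- From log y ≤ 4 y^(1/4) with y = T/τ: the powers of the logarithm are harmless against the
      -- factor τ.
      have hlog : l τ ^ 4 * τ ≤ 256 * T := by
        have hx : 0 < T / τ := by positivity
        have h1 := Real.log_le_rpow_div hx.le (ε := 1 / 4) (by norm_num)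
        have h2 : l τ ^ 4 ≤ ((T / τ) ^ (1 / 4 : ℝ) / (1 / 4)) ^ 4 := by gcongr
        have h3 : ((T / τ) ^ (1 / 4 : ℝ) / (1 / 4)) ^ 4 = 256 * (T / τ) := by
          rw [div_pow, ← Real.rpow_natCast ((T / τ) ^ (1 / 4 : ℝ)), ← Real.rpow_mul hx.le]
          norm_num; ring
        rw [h3, mul_div_assoc', le_div_iff₀ hτ0] at h2
        exact h2
      have h0 : 0 ≤ l τ * τ * Q τ := by positivity
      -- The constant is 1542 = 6 + 6 · 256.
      have hpoly : (1 + l τ ^ 2) * τ * (3 + 2 * l τ ^ 2) ≤ T * 1542 := by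
        have : (1 + l τ ^ 2) * (3 + 2 * l τ ^ 2) ≤ 6 + 6 * l τ ^ 4 := by
          nlinarith [sq_nonneg (l τ ^ 2 - 1)]
        have h2 : (1 + l τ ^ 2) * (3 + 2 * l τ ^ 2) * τ ≤ (6 + 6 * l τ ^ 4) * τ := by gcongr
        have := hτ.2
        linarith
      calc -2 * l τ * τ * Q τ - (1 + l τ ^ 2) * τ ^ 2 * D τ
          ≤ (1 + l τ ^ 2) * τ * (b ^ 2 * ((3 + 2 * l τ ^ 2) * Φ τ)) := by linarith
        _ = (1 + l τ ^ 2) * τ * (3 + 2 * l τ ^ 2) * (b ^ 2 * Φ τ) := by ring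
        _ ≤ T * 1542 * (b ^ 2 * Φ τ) := by gcongr
        _ = _ := by ring)
  have hR0 := h.R_nonneg s self_mem_Ici
  have hRT := h.R_nonneg T hsT
  have hPT := h.P_nonneg T hsT
  have hlT : l T = 0 := by simp [hl]
  have hls : 0 ≤ l s := Real.log_nonneg ((one_le_div hs).2 hsT)
  have hexp : Real.exp (b ^ 2 * T * 1542 * T - b ^ 2 * T * 1542 * s) ≤ Real.exp (4 * 1542) := by
    apply Real.exp_le_exp.2
    have h1 : 0 ≤ b ^ 2 * T * 1542 * s := by positivity
    have h3 : (b * T) ^ 2 ≤ 2 ^ 2 := by gcongr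
    nlinarith
  have hinit : Φ s = (1 + l s ^ 2) * (s ^ 2 * R s) := by simp [hΦ, h.S_init, h.P_init]
  have hE : T ^ 2 * (Q T + R T) ≤ 4 * Φ T := by
    have h1 : T ^ 2 * Q T ≤ 4 * P T := by
      calc T ^ 2 * Q T ≤ T ^ 2 * (b ^ 2 * P T) := by gcongr; exact h.Q_le T hsT
        _ = (b * T) ^ 2 * P T := by ring
        _ ≤ 2 ^ 2 * P T := by gcongr
        _ = _ := by ring
    have h2 : Φ T = P T + T ^ 2 * R T := by simp [hΦ, hlT]
    have h3 : 0 ≤ T ^ 2 * R T := by positivity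
    rw [h2]
    linarith
  have hfin : T ^ 2 * (Q T + R T) ≤ T ^ 2 *
      (Real.exp (4 * 1542) * 4 * ((s / T) ^ 2 * (1 + Real.log (T / s)) ^ 2) * R s) := by
    calc T ^ 2 * (Q T + R T) ≤ 4 * Φ T := hE
      _ ≤ 4 * (Real.exp (4 * 1542) * Φ s) := by
          have : 0 ≤ Φ s := by rw [hinit]; positivity
          gcongr
          exact hgr.trans (by gcongr)
      _ ≤ 4 * (Real.exp (4 * 1542) * ((1 + l s) ^ 2 * (s ^ 2 * R s))) := by
          rw [hinit]; gcongr; nlinarith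
      _ = _ := by simp only [hl]; field_simp
  exact le_of_mul_le_mul_left hfin (by positivity)

/-- The factor by which the bound before the oscillating regime is worse for `μ = 1`. -/
noncomputable def _root_.logFactor (μ x : ℝ) : ℝ := if μ = 1 then (1 + Real.log x) ^ 2 else 1

/-- The energy before the oscillating regime. -/
theorem energy_le_of_mul_le_two (μ : ℝ) :
    ∃ C : ℝ, 0 < C ∧ ∀ {s b : ℝ} {P Q R S D : ℝ → ℝ},
    0 < s → 0 ≤ b → EnergyQuantities μ s b P Q R S D →
    ∀ T : ℝ, s ≤ T → b * T ≤ 2 →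
      Q T + R T ≤ C * ((s / T) ^ (2 * min μ 1) * logFactor μ (T / s)) * R s := by
  rcases lt_trichotomy μ 1 with hμ | rfl | hμ
  · obtain ⟨C, hC, h⟩ := energy_le_of_mul_le_two_aux (μ := μ) (Or.inr ⟨rfl, hμ⟩)
    refine ⟨C, hC, fun hs hb hE T hsT hbT => (h hs hb hE T hsT hbT).trans_eq ?_⟩
    have hT := hs.trans_le hsT
    rw [min_eq_left hμ.le, logFactor, if_neg hμ.ne, mul_one, ← Real.rpow_natCast,
      ← Real.rpow_add (by positivity)]
    congr 3; push_cast; ring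
  · obtain ⟨C, hC, h⟩ := energy_le_of_mul_le_two_of_eq_one
    refine ⟨C, hC, fun hs hb hE T hsT hbT => (h hs hb hE T hsT hbT).trans_eq ?_⟩
    rw [logFactor, if_pos rfl, ← Real.rpow_natCast]
    simp
  · obtain ⟨C, hC, h⟩ := energy_le_of_mul_le_two_aux (μ := μ) (Or.inl ⟨rfl, hμ⟩)
    refine ⟨C, hC, fun hs hb hE T hsT hbT => (h hs hb hE T hsT hbT).trans_eq ?_⟩
    rw [min_eq_right hμ.le, logFactor, if_neg hμ.ne', ← Real.rpow_natCast]
    simp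

theorem _root_.one_le_logFactor (μ : ℝ) {x : ℝ} (hx : 1 ≤ x) : 1 ≤ logFactor μ x := by
  unfold logFactor
  split_ifs
  · have := Real.log_nonneg hx
    nlinarith
  · exact le_rfl

theorem _root_.logFactor_le_logFactor (μ : ℝ) {x y : ℝ} (hx : 1 ≤ x) (hxy : x ≤ y) :
    logFactor μ x ≤ logFactor μ y := by
  unfold logFactor
  split_ifs
  · have := Real.log_nonneg hx
    gcongr
  · exact le_rfl

/-- The energy in a frequency band `[a, b]` that passes from the non-oscillating to the oscillating
regime at time `T`. -/
theorem energy_le (μ : ℝ) :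
    ∃ C : ℝ, 0 < C ∧ ∀ {s b a : ℝ} {P Q R S D : ℝ → ℝ},
    0 < s → 0 < a → 0 ≤ b → EnergyQuantities μ s b P Q R S D →
    (∀ t ∈ Ici s, a ^ 2 * P t ≤ Q t) → ∀ T t : ℝ, s ≤ T → T ≤ t → b * T ≤ 2 → 1 ≤ a * T →
      Q t + R t ≤ C * (T / t) ^ μ * ((s / T) ^ (2 * min μ 1) * logFactor μ (t / s)) * R s := by
  obtain ⟨C₁, hC₁, h₁⟩ := energy_le_of_one_le μ
  obtain ⟨C₂, hC₂, h₂⟩ := energy_le_of_mul_le_two μ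
  refine ⟨C₁ * C₂, by positivity, ?_⟩
  intro s b a P Q R S D hs ha hb h hPQ T t hsT hTt hbT haT
  have hT := hs.trans_le hsT
  have ht := hT.trans_le hTt
  refine (h₁ hs ha h hPQ T t hsT hTt haT).trans ?_
  have hR := h.R_nonneg _ self_mem_Ici
  calc _ ≤ C₁ * (T / t) ^ μ * (C₂ * ((s / T) ^ (2 * min μ 1) * logFactor μ (T / s)) * R s) := by
        exact mul_le_mul_of_nonneg_left (h₂ hs hb h T hsT hbT) (by positivity)
    _ ≤ C₁ * (T / t) ^ μ * (C₂ * ((s / T) ^ (2 * min μ 1) * logFactor μ (t / s)) * R s) := by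
        have := logFactor_le_logFactor μ (x := T / s) (y := t / s) ((one_le_div hs).2 hsT)
          (by gcongr)
        have : 0 ≤ s / T := by positivity
        gcongr
    _ = _ := by ring

end EnergyQuantities

/-- The energy quantities of a solution of `x'' + K² x + (μ / t) x' = 0` in a Hilbert space. -/
theorem EnergyQuantities.of_hasDerivWithinAt {H : Type*} [NormedAddCommGroup H]
    [InnerProductSpace ℝ H] {μ s b : ℝ} (K : H →L[ℝ] H)
    (hK : ∀ x y, inner ℝ (K x) y = inner ℝ x (K y)) (hKb : ∀ x, ‖K x‖ ≤ b * ‖x‖) (hb : 0 ≤ b)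
    {x y : ℝ → H} (hx : ∀ t ∈ Ici s, HasDerivWithinAt x (y t) (Ici s) t)
    (hy : ∀ t ∈ Ici s, HasDerivWithinAt y (-K (K (x t)) - (μ / t) • y t) (Ici s) t)
    (hx0 : x s = 0) :
    EnergyQuantities μ s b (fun t => ‖x t‖ ^ 2) (fun t => ‖K (x t)‖ ^ 2) (fun t => ‖y t‖ ^ 2)
      (fun t => inner ℝ (x t) (y t)) (fun t => 2 * inner ℝ (K (x t)) (K (y t))) where
  hasDeriv_P t ht := (hx t ht).norm_sq
  hasDeriv_Q t ht := (K.hasFDerivAt.comp_hasDerivWithinAt t (hx t ht)).norm_sq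
  hasDeriv_R t ht := by
    refine (hy t ht).norm_sq.congr_deriv ?_
    rw [inner_sub_right, inner_neg_right, inner_smul_right, real_inner_self_eq_norm_sq,
      real_inner_comm, hK]
    ring
  hasDeriv_S t ht := by
    refine ((hx t ht).inner ℝ (hy t ht)).congr_deriv ?_
    rw [inner_sub_right, inner_neg_right, inner_smul_right, ← hK, real_inner_self_eq_norm_sq,
      real_inner_self_eq_norm_sq]
    ring
  P_nonneg t _ := by positivity
  Q_nonneg t _ := by positivity
  R_nonneg t _ := by positivity
  S_sq_le t _ := by
    rw [← mul_pow]
    exact sq_le_sq' (by linarith [neg_abs_le (inner ℝ (x t) (y t)), abs_real_inner_le_norm (x t) (y t)])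
      (real_inner_le_norm _ _)
  D_sq_le t _ := by
    have h1 : |inner ℝ (K (x t)) (K (y t))| ≤ b * ‖x t‖ * (b * ‖y t‖) :=
      (abs_real_inner_le_norm _ _).trans (by gcongr <;> apply hKb)
    calc (2 * inner ℝ (K (x t)) (K (y t))) ^ 2 = 4 * |inner ℝ (K (x t)) (K (y t))| ^ 2 := by
          rw [sq_abs]; ring
      _ ≤ 4 * (b * ‖x t‖ * (b * ‖y t‖)) ^ 2 := by gcongr
      _ = _ := by ring
  Q_le t _ := by
    rw [← mul_pow]
    gcongr
    exact hKb _
  P_init := by simp [hx0]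
  Q_init := by simp [hx0]
  S_init := by simp [hx0]

/-! ### Distributions and the Fourier transform on L² -/

section

open Filter
open scoped SchwartzMap Topology FourierTransform LineDeriv Laplacian

section Density

variable {E : Type*} [NormedAddCommGroup E] [InnerProductSpace ℝ E]

/-- Smooth functions of compact support are dense in the Schwartz space: a Schwartz function is the
limit of its products with dilated cut-off functions. -/
theorem SchwartzMap.exists_tendsto_hasCompactSupport [FiniteDimensional ℝ E] (f : 𝓢(E, ℂ)) :
    ∃ g : ℕ → 𝓢(E, ℂ), (∀ k, HasCompactSupport (g k)) ∧ Tendsto g atTop (𝓝 f) := by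
  let χ : ContDiffBump (0 : E) := ⟨1, 2, one_pos, one_lt_two⟩
  have hχ : ContDiff ℝ ∞ (χ : E → ℝ) := χ.contDiff
  let c : ℕ → ℝ := fun k => ((k : ℝ) + 1)⁻¹
  have hc0 : ∀ k, 0 < c k := fun k => by positivity
  have hc1 : ∀ k, c k ≤ 1 := fun k => inv_le_one_of_one_le₀ (by linarith [k.cast_nonneg (α := ℝ)])
  have hclim : Tendsto c atTop (𝓝 0) := by
    simpa [c, one_div] using tendsto_one_div_add_atTop_nhds_zero_nat (𝕜 := ℝ)
  have hsupp : ∀ k, HasCompactSupport (fun x : E => χ (c k • x)) := fun k =>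
    χ.hasCompactSupport.comp_homeomorph (Homeomorph.smulOfNeZero (c k) (hc0 k).ne')
  have hcs : ∀ k, HasCompactSupport (fun x : E => χ (c k • x) • f x) := fun k => (hsupp k).smul_right
  have hsm : ∀ k, ContDiff ℝ ∞ (fun x : E => χ (c k • x)) := fun k =>
    hχ.comp (contDiff_const_smul (c k))
  have hfs : ContDiff ℝ ∞ f := f.smooth ⊤
  refine ⟨fun k => (hcs k).toSchwartzMap ((hsm k).smul hfs), fun k => hcs k, ?_⟩
  rw [(schwartz_withSeminorms ℝ E ℂ).tendsto_nhds]
  rintro ⟨p, m⟩ ε hε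
  have hbound : ∀ i : ℕ, ∃ B : ℝ, 0 ≤ B ∧ ∀ x, ‖iteratedFDeriv ℝ i (fun x => χ x - 1) x‖ ≤ B := by
    intro i
    let χs : 𝓢(E, ℝ) := χ.hasCompactSupport.toSchwartzMap hχ
    refine ⟨SchwartzMap.seminorm ℝ 0 i χs + 1, by positivity, fun x => ?_⟩
    have h1 : iteratedFDeriv ℝ i (fun x => χ x - 1) x =
        iteratedFDeriv ℝ i χ x - iteratedFDeriv ℝ i (fun _ : E => (1 : ℝ)) x :=
      iteratedFDeriv_sub_apply (hχ.contDiffAt.of_le (by exact_mod_cast le_top))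
        contDiff_const.contDiffAt
    rw [h1]
    refine (norm_sub_le _ _).trans (add_le_add ?_ ?_)
    · exact χs.norm_iteratedFDeriv_le_seminorm ℝ i x
    · rcases Nat.eq_zero_or_pos i with rfl | hi
      · simp
      · rw [iteratedFDeriv_const_of_ne hi.ne']; simp
  choose B hB0 hB using hbound
  -- Where ‖c x‖ < 1 the function vanishes nearby; elsewhere c‖x‖ ≥ 1 may be inserted for free. One
  -- power of ‖x‖, absorbed by the Schwartz decay of f, thus buys the small factor c.
  have hu : ∀ k i x, ‖iteratedFDeriv ℝ i (fun x : E => χ (c k • x) - 1) x‖ ≤ c k * ‖x‖ * B i := by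
    intro k i x
    by_cases hx : ‖c k • x‖ < 1
    · have h0 : Filter.EventuallyEq (𝓝 x) (fun x : E => χ (c k • x) - 1) (fun _ => 0) := by
        have : ∀ᶠ y in 𝓝 x, ‖c k • y‖ < 1 :=
          (continuous_const_smul (c k)).norm.continuousAt.eventually_lt continuousAt_const hx
        filter_upwards [this] with y hy
        rw [χ.one_of_mem_closedBall (by simpa using hy.le), sub_self]
      rw [(h0.iteratedFDeriv ℝ i).eq_of_nhds]
      have : iteratedFDeriv ℝ i (fun _ : E => (0 : ℝ)) = 0 := iteratedFDeriv_fun_zero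
      have hc := hc0 k
      have hBi := hB0 i
      rw [this]
      simp only [Pi.zero_apply, norm_zero]
      positivity
    · have hx1 : 1 ≤ c k * ‖x‖ := by
        rw [norm_smul, Real.norm_of_nonneg (hc0 k).le] at hx; exact not_lt.1 hx
      let L : E →L[ℝ] E := c k • ContinuousLinearMap.id ℝ E
      have h1 := L.iteratedFDeriv_comp_right (f := fun x => χ x - 1) (n := ∞)
        (hχ.sub contDiff_const) x (i := i) (by exact_mod_cast le_top)
      have h2 : ((fun x => χ x - 1) ∘ L) = fun x : E => χ (c k • x) - 1 := by
        ext; simp [L]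
      rw [h2] at h1
      rw [h1]
      refine (ContinuousMultilinearMap.norm_compContinuousLinearMap_le _ _).trans ?_
      have hL : ‖L‖ ≤ 1 := by
        rw [norm_smul, Real.norm_of_nonneg (hc0 k).le]
        exact mul_le_one₀ (hc1 k) (norm_nonneg _) ContinuousLinearMap.norm_id_le
      have hprod : ∏ _j : Fin i, ‖L‖ ≤ 1 := by
        simp only [Finset.prod_const, Finset.card_univ, Fintype.card_fin]
        exact pow_le_one₀ (norm_nonneg _) hL
      calc _ ≤ B i * 1 := mul_le_mul (hB i _) hprod (by positivity) (hB0 i)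
        _ = 1 * B i := by ring
        _ ≤ c k * ‖x‖ * B i := mul_le_mul_of_nonneg_right hx1 (hB0 i)
  set A : ℝ := ∑ i ∈ Finset.range (m + 1), (m.choose i : ℝ) * B i *
    SchwartzMap.seminorm ℝ (p + 1) (m - i) f with hA
  have hA0 : 0 ≤ A := Finset.sum_nonneg fun i _ => by
    have := hB0 i
    positivity
  have hest : ∀ k, SchwartzMap.seminorm ℝ p m ((hcs k).toSchwartzMap ((hsm k).smul hfs) - f) ≤
      c k * A := by
    intro k
    have hc := hc0 k
    refine SchwartzMap.seminorm_le_bound ℝ p m _ (by positivity) fun x => ?_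
    have hfun : ⇑((hcs k).toSchwartzMap ((hsm k).smul hfs) - f) =
        fun x => (χ (c k • x) - 1) • f x := by
      ext x; simp [sub_smul]
    rw [hfun]
    have h1 := norm_iteratedFDeriv_smul_le (f := fun x : E => χ (c k • x) - 1) (g := f) (N := ∞)
      ((hsm k).sub contDiff_const) hfs x (n := m) (by exact_mod_cast le_top)
    calc ‖x‖ ^ p * ‖iteratedFDeriv ℝ m (fun x => (χ (c k • x) - 1) • f x) x‖
        ≤ ‖x‖ ^ p * ∑ i ∈ Finset.range (m + 1), (m.choose i : ℝ) *
          ‖iteratedFDeriv ℝ i (fun x : E => χ (c k • x) - 1) x‖ *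
            ‖iteratedFDeriv ℝ (m - i) f x‖ := by gcongr
      _ ≤ ‖x‖ ^ p * ∑ i ∈ Finset.range (m + 1), (m.choose i : ℝ) *
          (c k * ‖x‖ * B i) * ‖iteratedFDeriv ℝ (m - i) f x‖ := by
          gcongr with i hi; exact hu k i x
      _ = c k * ∑ i ∈ Finset.range (m + 1), (m.choose i : ℝ) * B i *
          (‖x‖ ^ (p + 1) * ‖iteratedFDeriv ℝ (m - i) f x‖) := by
          rw [Finset.mul_sum, Finset.mul_sum]
          exact Finset.sum_congr rfl fun i _ => by ring
      _ ≤ c k * A := by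
          rw [hA]
          gcongr with i hi
          · have := hB0 i
            positivity
          · exact f.le_seminorm ℝ (p + 1) (m - i) x
  have hlim : Tendsto (fun k => c k * A) atTop (𝓝 0) := by simpa using hclim.mul_const A
  filter_upwards [hlim.eventually_lt_const hε] with k hk
  exact (hest k).trans_lt hk

/-- A real test function as a complex Schwartz function. -/
noncomputable def realTestSchwartz (ψ : E → ℝ) (h₁ : HasCompactSupport ψ) (h₂ : ContDiff ℝ ∞ ψ) :
    𝓢(E, ℂ) :=
  HasCompactSupport.toSchwartzMap (f := fun x => (ψ x : ℂ)) (h₁.comp_left Complex.ofReal_zero)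
    (Complex.ofRealCLM.contDiff.comp h₂)

@[simp]
theorem realTestSchwartz_apply (ψ : E → ℝ) (h₁ : HasCompactSupport ψ) (h₂ : ContDiff ℝ ∞ ψ) (x : E) :
    realTestSchwartz ψ h₁ h₂ x = ψ x := rfl

/-- A tempered distribution is determined by its values on real test functions. -/
theorem TemperedDistribution.eq_zero_of_forall_realTestSchwartz [FiniteDimensional ℝ E] (T : 𝓢'(E, ℂ))
    (hT : ∀ ψ h₁ h₂, T (realTestSchwartz ψ h₁ h₂) = 0) : T = 0 := by
  ext f
  obtain ⟨g, hg, hlim⟩ := f.exists_tendsto_hasCompactSupport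
  have hz : ∀ k, T (g k) = 0 := by
    intro k
    have hs : ContDiff ℝ ∞ (g k) := (g k).smooth ⊤
    have c1 : HasCompactSupport fun x => (g k x).re := (hg k).comp_left (g := Complex.re) rfl
    have c2 : HasCompactSupport fun x => (g k x).im := (hg k).comp_left (g := Complex.im) rfl
    have s1 : ContDiff ℝ ∞ fun x => (g k x).re := Complex.reCLM.contDiff.comp hs
    have s2 : ContDiff ℝ ∞ fun x => (g k x).im := Complex.imCLM.contDiff.comp hs
    have e : g k = realTestSchwartz _ c1 s1 + Complex.I • realTestSchwartz _ c2 s2 := by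
      ext x
      simp [mul_comm Complex.I, Complex.re_add_im]
    rw [e, map_add, map_smul, hT, hT]
    simp
  have h1 : Tendsto (fun k => T (g k)) atTop (𝓝 (T f)) :=
    (T.continuous.tendsto f).comp hlim
  simp only [hz] at h1
  simpa using tendsto_nhds_unique h1 tendsto_const_nhds

end Density

section Fourier

variable {E : Type*} [NormedAddCommGroup E] [InnerProductSpace ℝ E]

theorem realTestSchwartz_smul_eq (ψ : E → ℝ) (h₁ : HasCompactSupport ψ) (h₂ : ContDiff ℝ ∞ ψ)
    (x : E) (z : ℂ) : realTestSchwartz ψ h₁ h₂ x • z = ψ x • z := by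
  simp

variable [FiniteDimensional ℝ E] [MeasurableSpace E] [BorelSpace E]

/-- Local integrability of h suffices, which admits unbounded symbols times L² functions and Fourier
integrals of L¹ functions. -/
theorem MeasureTheory.Lp.ae_eq_of_forall_realTestSchwartz {f : Lp ℂ 2 (volume : Measure E)}
    {h : E → ℂ} (hh : LocallyIntegrable h)
    (H : ∀ ψ h₁ h₂, (f : 𝓢'(E, ℂ)) (realTestSchwartz ψ h₁ h₂) = ∫ x, ψ x • h x) : f =ᵐ[volume] h := by
  refine ae_eq_of_integral_contDiff_smul_eq ((Lp.memLp f).locallyIntegrable one_le_two) hh ?_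
  intro ψ h₂ h₁
  rw [← H ψ h₁ h₂, Lp.toTemperedDistribution_apply]
  simp only [realTestSchwartz_smul_eq]

/-- Turns a distributional multiplier identity into a pointwise one. The symbol may be unbounded,
since m g is still locally integrable. -/
theorem MeasureTheory.Lp.ae_eq_of_smulLeftCLM {f g : Lp ℂ 2 (volume : Measure E)} {m : E → ℂ}
    (hm : m.HasTemperateGrowth) (c : ℂ)
    (H : (f : 𝓢'(E, ℂ)) = c • TemperedDistribution.smulLeftCLM ℂ m (g : 𝓢'(E, ℂ))) :
    f =ᵐ[volume] fun x => c * (m x * g x) := by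
  refine Lp.ae_eq_of_forall_realTestSchwartz ?_ ?_
  · have h1 : LocallyIntegrable (fun x => g x) := (Lp.memLp g).locallyIntegrable one_le_two
    rw [← locallyIntegrableOn_univ] at h1 ⊢
    have h2 := h1.continuousOn_smul isOpen_univ.isLocallyClosed (𝕜 := ℂ) (g := fun x => c * m x)
      (continuous_const.mul hm.1.continuous).continuousOn
    simpa [mul_assoc] using h2
  · intro ψ h₁ h₂
    rw [H]
    simp only [smul_apply, TemperedDistribution.smulLeftCLM_apply_apply,
      Lp.toTemperedDistribution_apply, SchwartzMap.smulLeftCLM_apply_apply hm,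
      realTestSchwartz_apply, smul_eq_mul, Complex.real_smul]
    rw [← integral_const_mul]
    congr 1 with x
    ring

/-- The `L²` Fourier transform of a partial derivative. -/
theorem MeasureTheory.Lp.fourier_ae_eq_of_lineDerivOp_eq {u g : Lp ℂ 2 (volume : Measure E)} (m : E)
    (h : ∂_{m} (u : 𝓢'(E, ℂ)) = (g : 𝓢'(E, ℂ))) :
    (𝓕 g : Lp ℂ 2 (volume : Measure E)) =ᵐ[volume] fun x =>
      (2 * Real.pi * Complex.I) * ((inner ℝ x m : ℝ) *
        (𝓕 u : Lp ℂ 2 (volume : Measure E)) x) := by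
  apply Lp.ae_eq_of_smulLeftCLM (m := fun x => ((inner ℝ x m : ℝ) : ℂ)) (by fun_prop)
  rw [← Lp.fourier_toTemperedDistribution_eq, ← h, TemperedDistribution.fourier_lineDerivOp_eq,
    Lp.fourier_toTemperedDistribution_eq]

/-- The `L²` Fourier transform of a Laplacian. -/
theorem MeasureTheory.Lp.fourier_ae_eq_of_laplacian_eq {u g : Lp ℂ 2 (volume : Measure E)}
    (h : Δ (u : 𝓢'(E, ℂ)) = (g : 𝓢'(E, ℂ))) :
    (𝓕 g : Lp ℂ 2 (volume : Measure E)) =ᵐ[volume] fun x =>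
      (-(2 * Real.pi) ^ 2 : ℂ) * (((‖x‖ ^ 2 : ℝ) : ℂ) * (𝓕 u : Lp ℂ 2 (volume : Measure E)) x) := by
  apply Lp.ae_eq_of_smulLeftCLM (m := fun x => ((‖x‖ ^ 2 : ℝ) : ℂ)) (by fun_prop)
  rw [← Lp.fourier_toTemperedDistribution_eq, ← h,
    TemperedDistribution.laplacian_eq_fourierMultiplierCLM,
    TemperedDistribution.fourierMultiplierCLM_apply, ← Lp.fourier_toTemperedDistribution_eq]
  ext
  simp

/-- The `L²` Fourier transform of an integrable function is bounded by the `L¹` norm. -/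
theorem MeasureTheory.Lp.norm_fourier_le_ae {f : Lp ℂ 2 (volume : Measure E)}
    (hf : MemLp f 1 volume) :
    ∀ᵐ ξ, ‖(𝓕 f : Lp ℂ 2 (volume : Measure E)) ξ‖ ≤ (eLpNorm f 1 volume).toReal := by
  have hintegrable : Integrable f := memLp_one_iff_integrable.1 hf
  -- The L² transform agrees with the Fourier integral: both are tested by moving the transform onto
  -- the test function.
  have key : (𝓕 f : Lp ℂ 2 (volume : Measure E)) =ᵐ[volume] 𝓕 (f : E → ℂ) := by
    refine Lp.ae_eq_of_forall_realTestSchwartz ?_ ?_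
    · exact (VectorFourier.fourierIntegral_continuous Real.continuous_fourierChar
        continuous_inner hintegrable).locallyIntegrable
    · intro ψ h₁ h₂
      rw [← Lp.fourier_toTemperedDistribution_eq, TemperedDistribution.fourier_apply,
        Lp.toTemperedDistribution_apply]
      have := VectorFourier.integral_fourierIntegral_smul_eq_flip (L := innerₗ E)
        Real.continuous_fourierChar continuous_inner
        (realTestSchwartz ψ h₁ h₂).integrable (μ := volume) (ν := volume) hintegrable
      simp only [realTestSchwartz_smul_eq, flip_innerₗ] at this
      exact this
  filter_upwards [key] with ξ hξ
  rw [hξ, eLpNorm_one_eq_lintegral_enorm, ← integral_norm_eq_lintegral_enorm hintegrable.1]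
  exact VectorFourier.norm_fourierIntegral_le_integral_norm _ _ _ _ _

end Fourier

theorem MeasureTheory.Lp.integrable_norm_sq {α F : Type*} [MeasurableSpace α] {ν : Measure α}
    [NormedAddCommGroup F] (f : Lp F 2 ν) : Integrable (fun x => ‖f x‖ ^ 2) ν := by
  simpa using (Lp.memLp f).integrable_norm_pow (p := 2) two_ne_zero

theorem MeasureTheory.Lp.norm_sq_eq_integral {α F : Type*} [MeasurableSpace α] {ν : Measure α}
    [NormedAddCommGroup F] (f : Lp F 2 ν) : ‖f‖ ^ 2 = ∫ x, ‖f x‖ ^ 2 ∂ν := by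
  have h0 : 0 ≤ ∫ x, ‖f x‖ ^ 2 ∂ν := integral_nonneg fun x => by positivity
  rw [Lp.norm_def, (Lp.memLp f).eLpNorm_eq_integral_rpow_norm two_ne_zero ENNReal.ofNat_ne_top,
    ENNReal.toReal_ofReal (by positivity)]
  simp only [ENNReal.toReal_ofNat, Real.rpow_ofNat]
  rw [← Real.rpow_natCast, ← Real.rpow_mul h0]
  norm_num

/-! ### From real or complex scalars to complex tempered distributions -/

section Complexification

variable {n : ℕ} {𝕜 : Type*} [RCLike 𝕜]

/-- The real-linear isometric embedding of `𝕜` into `ℂ`. -/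
noncomputable def RCLike.toComplexₗᵢ (𝕜 : Type*) [RCLike 𝕜] : 𝕜 →ₗᵢ[ℝ] ℂ where
  toLinearMap := (RCLike.map 𝕜 ℂ).toLinearMap
  norm_map' z := by
    have h : ‖RCLike.map 𝕜 ℂ z‖ ^ 2 = ‖z‖ ^ 2 := by
      rw [← RCLike.normSq_eq_def' z, RCLike.normSq_apply, ← Complex.normSq_eq_norm_sq,
        Complex.normSq_apply]
      simp
    exact (pow_left_inj₀ (norm_nonneg _) (norm_nonneg _) two_ne_zero).1 h

/-- A scalar `L²` function as a complex `L²` function. -/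
noncomputable def toComplexL2 (n : ℕ) (𝕜 : Type*) [RCLike 𝕜] : L2 n 𝕜 →L[ℝ] L2 n ℂ :=
  (RCLike.toComplexₗᵢ 𝕜).toContinuousLinearMap.compLpL 2 volume

/-- A component of an `L²` vector field as a complex `L²` function. -/
noncomputable def coordComplexL2 (n : ℕ) (𝕜 : Type*) [RCLike 𝕜] (i : Fin n) :
    L2 n (EuclideanSpace 𝕜 (Fin n)) →L[ℝ] L2 n ℂ :=
  ((RCLike.toComplexₗᵢ 𝕜).toContinuousLinearMap ∘L
    (PiLp.proj 2 (fun _ : Fin n => 𝕜) i : PiLp 2 (fun _ : Fin n => 𝕜) →L[ℝ] 𝕜)).compLpL 2 volume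

theorem toComplexL2_ae (f : L2 n 𝕜) :
    toComplexL2 n 𝕜 f =ᵐ[volume] fun x => RCLike.toComplexₗᵢ 𝕜 (f x) :=
  ContinuousLinearMap.coeFn_compLpL _ f

theorem coordComplexL2_ae (i : Fin n) (f : L2 n (EuclideanSpace 𝕜 (Fin n))) :
    coordComplexL2 n 𝕜 i f =ᵐ[volume] fun x => RCLike.toComplexₗᵢ 𝕜 (f x i) :=
  ContinuousLinearMap.coeFn_compLpL _ f

theorem norm_toComplexL2 (f : L2 n 𝕜) : ‖toComplexL2 n 𝕜 f‖ = ‖f‖ := by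
  rw [Lp.norm_def, Lp.norm_def]
  congr 1
  apply eLpNorm_congr_norm_ae
  filter_upwards [toComplexL2_ae f] with x hx
  rw [hx, LinearIsometry.norm_map]

theorem sum_norm_sq_coordComplexL2 (f : L2 n (EuclideanSpace 𝕜 (Fin n))) :
    ∑ i, ‖coordComplexL2 n 𝕜 i f‖ ^ 2 = ‖f‖ ^ 2 := by
  simp only [Lp.norm_sq_eq_integral]
  rw [← integral_finsetSum _ fun i _ => Lp.integrable_norm_sq _]
  apply integral_congr_ae
  have : ∀ᵐ x, ∀ i, coordComplexL2 n 𝕜 i f x = RCLike.toComplexₗᵢ 𝕜 (f x i) :=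
    ae_all_iff.2 fun i => coordComplexL2_ae i f
  filter_upwards [this] with x hx
  simp only [hx, LinearIsometry.norm_map]
  rw [EuclideanSpace.norm_sq_eq]

theorem toComplexL2_realTestSchwartz (f : L2 n 𝕜) (ψ : EuclideanSpace ℝ (Fin n) → ℝ) (h₁ h₂) :
    (toComplexL2 n 𝕜 f : 𝓢'(EuclideanSpace ℝ (Fin n), ℂ)) (realTestSchwartz ψ h₁ h₂) =
      RCLike.toComplexₗᵢ 𝕜 (∫ x, ψ x • f x) := by
  rw [Lp.toTemperedDistribution_apply, ← LinearIsometry.integral_comp_comm]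
  apply integral_congr_ae
  filter_upwards [toComplexL2_ae f] with x hx
  rw [hx, realTestSchwartz_smul_eq, map_smul]

theorem coordComplexL2_realTestSchwartz (i : Fin n) (f : L2 n (EuclideanSpace 𝕜 (Fin n)))
    (ψ : EuclideanSpace ℝ (Fin n) → ℝ) (h₁ h₂) :
    (coordComplexL2 n 𝕜 i f : 𝓢'(EuclideanSpace ℝ (Fin n), ℂ)) (realTestSchwartz ψ h₁ h₂) =
      RCLike.toComplexₗᵢ 𝕜 (∫ x, ψ x • f x i) := by
  rw [Lp.toTemperedDistribution_apply, ← LinearIsometry.integral_comp_comm]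
  apply integral_congr_ae
  filter_upwards [coordComplexL2_ae i f] with x hx
  rw [hx, realTestSchwartz_smul_eq, map_smul]

theorem IsTestFunction.partialDeriv {ψ : EuclideanSpace ℝ (Fin n) → ℝ} (h : IsTestFunction ψ)
    (i : Fin n) : IsTestFunction (partialDeriv i ψ) := by
  refine ⟨(h.1.fderiv_right (m := ∞) (by simp)).clm_apply contDiff_const, ?_⟩
  exact h.2.fderiv_apply ℝ _

theorem lineDerivOp_realTestSchwartz {ψ : EuclideanSpace ℝ (Fin n) → ℝ} (h : IsTestFunction ψ)
    (i : Fin n) :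
    ∂_{EuclideanSpace.single i (1 : ℝ)} (realTestSchwartz ψ h.2 h.1) =
      realTestSchwartz (partialDeriv i ψ) (h.partialDeriv i).2 (h.partialDeriv i).1 := by
  ext x
  rw [SchwartzMap.lineDerivOp_apply_eq_fderiv, realTestSchwartz_apply]
  have h1 : HasFDerivAt ψ (fderiv ℝ ψ x) x := (h.1.differentiable (by simp) x).hasFDerivAt
  have h2 : HasFDerivAt (fun x => (ψ x : ℂ)) (Complex.ofRealCLM ∘L fderiv ℝ ψ x) x :=
    Complex.ofRealCLM.hasFDerivAt.comp x h1
  have h3 : fderiv ℝ (realTestSchwartz ψ h.2 h.1) x = Complex.ofRealCLM ∘L fderiv ℝ ψ x := h2.fderiv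
  rw [h3]
  rfl

theorem IsWeakGradient.lineDerivOp_eq {u : L2 n 𝕜} {g : L2 n (EuclideanSpace 𝕜 (Fin n))}
    (h : IsWeakGradient u g) (i : Fin n) :
    ∂_{EuclideanSpace.single i (1 : ℝ)}
      (toComplexL2 n 𝕜 u : 𝓢'(EuclideanSpace ℝ (Fin n), ℂ)) = coordComplexL2 n 𝕜 i g := by
  rw [← sub_eq_zero]
  apply TemperedDistribution.eq_zero_of_forall_realTestSchwartz
  intro ψ h₁ h₂
  have hψ : IsTestFunction ψ := ⟨h₂, h₁⟩
  rw [sub_apply, TemperedDistribution.lineDerivOp_apply_apply, map_neg,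
    lineDerivOp_realTestSchwartz hψ, toComplexL2_realTestSchwartz, coordComplexL2_realTestSchwartz,
    h ψ hψ i, map_neg, neg_neg, sub_self]

namespace IsEnergySolution

variable {μ s : ℝ} {v₁ : EuclideanSpace ℝ (Fin n) → 𝕜} {v : ℝ → L2 n 𝕜}
  {Dv : ℝ → L2 n (EuclideanSpace 𝕜 (Fin n))} {vt : ℝ → L2 n 𝕜}

/-- The equation in the sense of distributions in space. -/
theorem hasDerivAt_realTestSchwartz (h : IsEnergySolution μ s v₁ v Dv vt)
    {ψ : EuclideanSpace ℝ (Fin n) → ℝ} (h₁ : HasCompactSupport ψ) (h₂ : ContDiff ℝ ∞ ψ) {t : ℝ}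
    (ht : s < t) :
    HasDerivAt (fun τ => (toComplexL2 n 𝕜 (vt τ) : 𝓢'(EuclideanSpace ℝ (Fin n), ℂ))
        (realTestSchwartz ψ h₁ h₂))
      ((toComplexL2 n 𝕜 (v t) : 𝓢'(EuclideanSpace ℝ (Fin n), ℂ)) (Δ (realTestSchwartz ψ h₁ h₂)) -
        (μ / t) • (toComplexL2 n 𝕜 (vt t) : 𝓢'(EuclideanSpace ℝ (Fin n), ℂ))
          (realTestSchwartz ψ h₁ h₂)) t := by
  have hψ : IsTestFunction ψ := ⟨h₂, h₁⟩
  have h0 := (RCLike.toComplexₗᵢ 𝕜).toContinuousLinearMap.hasFDerivAt.comp_hasDerivAt t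
    (h.equation ψ hψ t ht)
  simp only [toComplexL2_realTestSchwartz]
  refine h0.congr_deriv ?_
  have hintegrable : ∀ i, Integrable (fun x => partialDeriv i ψ x • Dv t x i) := by
    intro i
    have m1 : MemLp (partialDeriv i ψ) 2 volume :=
      (hψ.partialDeriv i).1.continuous.memLp_of_hasCompactSupport (hψ.partialDeriv i).2
    have m2 : MemLp (fun x => Dv t x i) 2 volume :=
      (PiLp.proj 2 (fun _ : Fin n => 𝕜) i : PiLp 2 (fun _ : Fin n => 𝕜) →L[ℝ] 𝕜).comp_memLp' (Lp.memLp (Dv t))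
    exact memLp_one_iff_integrable.1 (m2.smul m1)
  -- Of the two derivatives in each summand of the Laplacian, one falls on v as the weak gradient
  -- and the other is moved to the test function.
  have key : (toComplexL2 n 𝕜 (v t) : 𝓢'(EuclideanSpace ℝ (Fin n), ℂ))
      (Δ (realTestSchwartz ψ h₁ h₂)) =
      RCLike.toComplexₗᵢ 𝕜 (-∫ x, ∑ i, partialDeriv i ψ x • Dv t x i) := by
    rw [← TemperedDistribution.laplacian_apply_apply,
      TemperedDistribution.laplacian_eq_sum (EuclideanSpace.basisFun (Fin n) ℝ)]
    simp only [EuclideanSpace.basisFun_apply, (h.weakGradient t ht.le).lineDerivOp_eq]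
    rw [integral_finsetSum _ fun i _ => hintegrable i, map_neg, map_sum, ← Finset.sum_neg_distrib,
      sum_apply]
    refine Finset.sum_congr rfl fun i _ => ?_
    rw [TemperedDistribution.lineDerivOp_apply_apply, map_neg, lineDerivOp_realTestSchwartz hψ,
      coordComplexL2_realTestSchwartz]
  rw [key]
  simp [map_sub]

end IsEnergySolution

end Complexification

/-- The fundamental theorem of calculus including the endpoint s, obtained by extending f to the
left as a constant. -/
theorem hasDerivWithinAt_Ici_of_eq_integral {H : Type*} [NormedAddCommGroup H] [NormedSpace ℝ H]
    [CompleteSpace H] {s : ℝ} {y f : ℝ → H} (hf : ContinuousOn f (Ici s))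
    (h : ∀ t ∈ Ici s, y t = y s + ∫ τ in s..t, f τ) {t : ℝ} (ht : t ∈ Ici s) :
    HasDerivWithinAt y (f t) (Ici s) t := by
  have hc : Continuous (fun τ => f (max s τ)) :=
    hf.comp_continuous (continuous_const.max continuous_id) fun τ => le_max_left s τ
  have h1 : HasDerivAt (fun t => y s + ∫ τ in s..t, f (max s τ)) (f (max s t)) t :=
    (hc.integral_hasStrictDerivAt s t).hasDerivAt.const_add (y s)
  rw [max_eq_right ht] at h1
  have h2 : ∀ r ∈ Ici s, y r = y s + ∫ τ in s..r, f (max s τ) := by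
    intro r hr
    rw [h r hr]
    congr 1
    apply intervalIntegral.integral_congr
    intro τ hτ
    rw [uIcc_of_le hr] at hτ
    simp only [max_eq_right hτ.1]
  exact h1.hasDerivWithinAt.congr h2 (h2 t ht)

/-! ### The equation in integrated form -/

section Evolution

variable {E : Type*} [NormedAddCommGroup E] [InnerProductSpace ℝ E] [FiniteDimensional ℝ E]
  [MeasurableSpace E] [BorelSpace E]

/-- The pairing of an `L²` function with a Schwartz function. -/
noncomputable def l2PairingL (φ : 𝓢(E, ℂ)) : Lp ℂ 2 (volume : Measure E) →L[ℝ] ℂ :=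
  ((PointwiseConvergenceCLM.evalCLM (RingHom.id ℂ) ℂ φ) ∘L
    (Lp.toTemperedDistributionCLM ℂ (volume : Measure E) 2)).restrictScalars ℝ

theorem l2PairingL_apply (φ : 𝓢(E, ℂ)) (f : Lp ℂ 2 (volume : Measure E)) :
    l2PairingL φ f = (f : 𝓢'(E, ℂ)) φ := rfl

/-- The `L²` Fourier transform as a real-linear map. -/
noncomputable def l2FourierL (E : Type*) [NormedAddCommGroup E] [InnerProductSpace ℝ E]
    [FiniteDimensional ℝ E] [MeasurableSpace E] [BorelSpace E] :
    Lp ℂ 2 (volume : Measure E) →L[ℝ] Lp ℂ 2 (volume : Measure E) :=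
  (Lp.fourierTransformₗᵢ E ℂ).toContinuousLinearEquiv.toContinuousLinearMap.restrictScalars ℝ

theorem l2FourierL_apply (f : Lp ℂ 2 (volume : Measure E)) : l2FourierL E f = 𝓕 f := rfl

theorem norm_l2FourierL (f : Lp ℂ 2 (volume : Measure E)) : ‖l2FourierL E f‖ = ‖f‖ :=
  Lp.norm_fourier_eq f

/-- The damped wave equation integrated in time. -/
theorem laplacian_integral_eq {μ s : ℝ} (hs : 0 < s) {u w : ℝ → Lp ℂ 2 (volume : Measure E)}
    (hu : ContinuousOn u (Ici s)) (hw : ContinuousOn w (Ici s))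
    (heq : ∀ (ψ : E → ℝ) h₁ h₂ t, s < t →
      HasDerivAt (fun τ => (w τ : 𝓢'(E, ℂ)) (realTestSchwartz ψ h₁ h₂))
        ((u t : 𝓢'(E, ℂ)) (Δ (realTestSchwartz ψ h₁ h₂)) -
          (μ / t) • (w t : 𝓢'(E, ℂ)) (realTestSchwartz ψ h₁ h₂)) t) {t : ℝ} (ht : t ∈ Ici s) :
    Δ ((∫ τ in s..t, u τ : Lp ℂ 2 (volume : Measure E)) : 𝓢'(E, ℂ)) =
      ((w t - w s + ∫ τ in s..t, (μ / τ) • w τ : Lp ℂ 2 (volume : Measure E)) : 𝓢'(E, ℂ)) := by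
  rw [← sub_eq_zero]
  apply TemperedDistribution.eq_zero_of_forall_realTestSchwartz
  intro ψ h₁ h₂
  have hsub : Icc s t ⊆ Ici s := Icc_subset_Ici_self
  have hst : s ≤ t := ht
  have hw' : ContinuousOn (fun τ => (μ / τ) • w τ) (Icc s t) := by
    refine (continuousOn_const.div continuousOn_id fun τ hτ => ?_).smul (hw.mono hsub)
    exact (hs.trans_le hτ.1).ne'
  have iu : IntervalIntegrable u volume s t :=
    (hu.mono hsub).intervalIntegrable_of_Icc hst
  have iw : IntervalIntegrable (fun τ => (μ / τ) • w τ) volume s t :=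
    hw'.intervalIntegrable_of_Icc hst
  set Ψ := realTestSchwartz ψ h₁ h₂
  have hd : ContinuousOn (fun τ => l2PairingL (Δ Ψ) (u τ) - l2PairingL Ψ ((μ / τ) • w τ))
      (Icc s t) :=
    ((l2PairingL (Δ Ψ)).continuous.comp_continuousOn (hu.mono hsub)).sub
      ((l2PairingL Ψ).continuous.comp_continuousOn hw')
  -- The equation is needed only inside the interval; continuity of w covers the endpoint s.
  have hF := intervalIntegral.integral_eq_sub_of_hasDerivAt_of_le hst
    (f := fun τ => l2PairingL Ψ (w τ))
    (f' := fun τ => l2PairingL (Δ Ψ) (u τ) - l2PairingL Ψ ((μ / τ) • w τ))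
    ((l2PairingL Ψ).continuous.comp_continuousOn (hw.mono hsub))
    (fun τ hτ => by
      refine (heq ψ h₁ h₂ τ hτ.1).congr_deriv ?_
      rw [map_smul]; rfl)
    (hd.intervalIntegrable_of_Icc hst)
  have iu' : IntervalIntegrable (fun τ => l2PairingL (Δ Ψ) (u τ)) volume s t :=
    ((l2PairingL (Δ Ψ)).continuous.comp_continuousOn (hu.mono hsub)).intervalIntegrable_of_Icc hst
  have iw' : IntervalIntegrable (fun τ => l2PairingL Ψ ((μ / τ) • w τ)) volume s t :=
    ((l2PairingL Ψ).continuous.comp_continuousOn hw').intervalIntegrable_of_Icc hst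
  rw [intervalIntegral.integral_sub iu' iw',
    ContinuousLinearMap.intervalIntegral_comp_comm _ iu,
    ContinuousLinearMap.intervalIntegral_comp_comm _ iw] at hF
  rw [sub_apply, TemperedDistribution.laplacian_apply_apply, ← l2PairingL_apply,
    ← l2PairingL_apply, map_add, map_sub, ← hF]
  ring

end Evolution

/-! ### Multipliers, frequency bands and their energy -/

section Multiplier

variable {α : Type*} [MeasurableSpace α] {ν : Measure α}

/-- Multiplication by a bounded real function on `L²`. -/
noncomputable def l2MulL {m : α → ℝ} (hm : MemLp m ⊤ ν) : Lp ℂ 2 ν →L[ℝ] Lp ℂ 2 ν :=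
  (ContinuousLinearMap.lsmul ℝ ℝ : ℝ →L[ℝ] ℂ →L[ℝ] ℂ).holderL ν ⊤ 2 2 (hm.toLp m)

theorem l2MulL_ae {m : α → ℝ} (hm : MemLp m ⊤ ν) (f : Lp ℂ 2 ν) :
    l2MulL hm f =ᵐ[ν] fun x => m x • f x := by
  have h1 : l2MulL hm f =ᵐ[ν] fun x => (hm.toLp m) x • f x :=
    ContinuousLinearMap.coeFn_holder (r := 2) (ContinuousLinearMap.lsmul ℝ ℝ) (hm.toLp m) f
  filter_upwards [h1, hm.coeFn_toLp] with x hx hx'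
  rw [hx, hx']

theorem inner_l2MulL {m : α → ℝ} (hm : MemLp m ⊤ ν) (f g : Lp ℂ 2 ν) :
    inner ℝ (l2MulL hm f) g = inner ℝ f (l2MulL hm g) := by
  rw [L2.inner_def, L2.inner_def]
  apply integral_congr_ae
  filter_upwards [l2MulL_ae hm f, l2MulL_ae hm g] with x h1 h2
  rw [h1, h2, real_inner_smul_left, real_inner_smul_right]

theorem norm_sq_l2MulL {m : α → ℝ} (hm : MemLp m ⊤ ν) (f : Lp ℂ 2 ν) :
    ‖l2MulL hm f‖ ^ 2 = ∫ x, m x ^ 2 * ‖f x‖ ^ 2 ∂ν := by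
  rw [Lp.norm_sq_eq_integral]
  apply integral_congr_ae
  filter_upwards [l2MulL_ae hm f] with x h1
  rw [h1, norm_smul, mul_pow, Real.norm_eq_abs, sq_abs]

theorem integrable_sq_mul_norm_sq {m : α → ℝ} (hm : MemLp m ⊤ ν) (f : Lp ℂ 2 ν) :
    Integrable (fun x => m x ^ 2 * ‖f x‖ ^ 2) ν := by
  refine (Lp.integrable_norm_sq (l2MulL hm f)).congr ?_
  filter_upwards [l2MulL_ae hm f] with x h1
  rw [h1, norm_smul, mul_pow, Real.norm_eq_abs, sq_abs]

end Multiplier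

section Band

variable {E : Type*} [NormedAddCommGroup E]

/-- The frequencies `ξ` with `lo < 2π|ξ| ≤ hi`. -/
def freqBand (E : Type*) [NormedAddCommGroup E] (lo hi : ℝ) : Set E :=
  {ξ | 2 * Real.pi * ‖ξ‖ ∈ Ioc lo hi}

theorem measurableSet_freqBand [MeasurableSpace E] [BorelSpace E] (lo hi : ℝ) : MeasurableSet (freqBand E lo hi) :=
  measurableSet_Ioc.preimage (continuous_const.mul continuous_norm).measurable

/-- The symbol of the square root of minus the Laplacian, cut off to a frequency band. -/
noncomputable def bandSymbol (E : Type*) [NormedAddCommGroup E] (lo hi : ℝ) : E → ℝ :=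
  (freqBand E lo hi).indicator fun ξ => 2 * Real.pi * ‖ξ‖

theorem abs_bandSymbol_le {lo hi : ℝ} (hhi : 0 ≤ hi) (ξ : E) : |bandSymbol E lo hi ξ| ≤ hi := by
  unfold bandSymbol
  by_cases h : ξ ∈ freqBand E lo hi
  · rw [indicator_of_mem h, abs_of_nonneg (by positivity)]
    exact h.2
  · rwa [indicator_of_notMem h, abs_zero]

theorem memLp_bandSymbol [MeasurableSpace E] [BorelSpace E] {lo hi : ℝ} (hhi : 0 ≤ hi) (ν : Measure E) :
    MemLp (bandSymbol E lo hi) ⊤ ν := by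
  refine memLp_top_of_bound (C := hi) ?_ (ae_of_all _ fun ξ => abs_bandSymbol_le hhi ξ)
  exact ((by fun_prop : Measurable fun ξ : E => 2 * Real.pi * ‖ξ‖).indicator
    (measurableSet_freqBand lo hi)).aestronglyMeasurable

theorem memLp_freqBand_indicator [MeasurableSpace E] [BorelSpace E] (lo hi : ℝ) (ν : Measure E) :
    MemLp ((freqBand E lo hi).indicator fun _ => (1 : ℝ)) ⊤ ν := by
  refine memLp_top_of_bound (C := 1) ?_ (ae_of_all _ fun ξ => ?_)
  · exact (measurable_const.indicator (measurableSet_freqBand lo hi)).aestronglyMeasurable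
  · exact (norm_indicator_le_norm_self _ _).trans (by simp)

end Band

section BandEnergy

variable {E : Type*} [NormedAddCommGroup E] [InnerProductSpace ℝ E] [FiniteDimensional ℝ E]
  [MeasurableSpace E] [BorelSpace E]

/-- The energy in a frequency band. -/
noncomputable def bandEnergy (lo hi : ℝ) (V W : Lp ℂ 2 (volume : Measure E)) : ℝ :=
  ∫ ξ in freqBand E lo hi, (2 * Real.pi * ‖ξ‖) ^ 2 * ‖V ξ‖ ^ 2 + ‖W ξ‖ ^ 2

theorem bandEnergy_eq {lo hi : ℝ} (hhi : 0 ≤ hi) (V W : Lp ℂ 2 (volume : Measure E)) :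
    bandEnergy lo hi V W = ‖l2MulL (memLp_bandSymbol (lo := lo) hhi volume)
        (l2MulL (memLp_freqBand_indicator lo hi volume) V)‖ ^ 2 +
      ‖l2MulL (memLp_freqBand_indicator lo hi volume) W‖ ^ 2 := by
  rw [norm_sq_l2MulL, norm_sq_l2MulL, bandEnergy,
    ← integral_add (integrable_sq_mul_norm_sq (memLp_bandSymbol hhi volume) _)
      (integrable_sq_mul_norm_sq (memLp_freqBand_indicator lo hi volume) _),
    ← integral_indicator (measurableSet_freqBand lo hi)]
  apply integral_congr_ae
  filter_upwards [l2MulL_ae (memLp_freqBand_indicator lo hi volume) V] with ξ hξ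
  rw [hξ]
  by_cases h : ξ ∈ freqBand E lo hi
  · simp [bandSymbol, h]
  · simp [bandSymbol, h]

/-- On the band the symbol -(2π|ξ|)² equals minus the square of the truncated symbol, so the
Laplacian becomes -K² with K bounded. -/
theorem l2MulL_freqBand_eq_of_laplacian_symbol {lo hi : ℝ} (hhi : 0 ≤ hi) {a b : Lp ℂ 2 (volume : Measure E)}
    (h : ∀ᵐ ξ, b ξ = (-(2 * Real.pi) ^ 2 : ℂ) * (((‖ξ‖ ^ 2 : ℝ) : ℂ) * a ξ)) :
    l2MulL (memLp_freqBand_indicator lo hi volume) b =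
      -l2MulL (memLp_bandSymbol (lo := lo) hhi volume)
        (l2MulL (memLp_bandSymbol (lo := lo) hhi volume)
          (l2MulL (memLp_freqBand_indicator lo hi volume) a)) := by
  apply Lp.ext
  filter_upwards [h, l2MulL_ae (memLp_freqBand_indicator lo hi volume) b,
    Lp.coeFn_neg (l2MulL (memLp_bandSymbol (lo := lo) hhi volume)
        (l2MulL (memLp_bandSymbol (lo := lo) hhi volume)
          (l2MulL (memLp_freqBand_indicator lo hi volume) a))),
    l2MulL_ae (memLp_bandSymbol (lo := lo) hhi volume)
        (l2MulL (memLp_bandSymbol (lo := lo) hhi volume)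
          (l2MulL (memLp_freqBand_indicator lo hi volume) a)),
    l2MulL_ae (memLp_bandSymbol (lo := lo) hhi volume)
          (l2MulL (memLp_freqBand_indicator lo hi volume) a),
    l2MulL_ae (memLp_freqBand_indicator lo hi volume) a] with ξ h0 h1 h2 h3 h4 h5
  rw [h1, h2, Pi.neg_apply, h3, h4, h5, h0]
  by_cases h : ξ ∈ freqBand E lo hi
  · simp [bandSymbol, h]
    ring
  · simp [bandSymbol, h]

/-- The parts of `V = 𝓕 u` and `W = 𝓕 u'` in a frequency band satisfy the energy identities. -/
theorem energyQuantities_band {μ s lo hi : ℝ} (hs : 0 < s) (hhi : 0 ≤ hi)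
    {u w : ℝ → Lp ℂ 2 (volume : Measure E)} (hw : ContinuousOn w (Ici s))
    (hu : ∀ t ∈ Ici s, HasDerivWithinAt u (w t) (Ici s) t) (hus : u s = 0)
    (heq : ∀ (ψ : E → ℝ) h₁ h₂ t, s < t →
      HasDerivAt (fun τ => (w τ : 𝓢'(E, ℂ)) (realTestSchwartz ψ h₁ h₂))
        ((u t : 𝓢'(E, ℂ)) (Δ (realTestSchwartz ψ h₁ h₂)) -
          (μ / t) • (w t : 𝓢'(E, ℂ)) (realTestSchwartz ψ h₁ h₂)) t) :
    ∃ P Q R S D : ℝ → ℝ, EnergyQuantities μ s hi P Q R S D ∧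
      (∀ t, 0 ≤ lo → lo ^ 2 * P t ≤ Q t) ∧
      (∀ t, Q t + R t = bandEnergy lo hi (l2FourierL E (u t)) (l2FourierL E (w t))) ∧
      (∀ t, R t = ∫ ξ in freqBand E lo hi, ‖l2FourierL E (w t) ξ‖ ^ 2) := by
  set X := l2MulL (memLp_freqBand_indicator (E := E) lo hi volume) with hX
  set K := l2MulL (memLp_bandSymbol (E := E) (lo := lo) hhi volume) with hK
  have hKb : ∀ x, ‖K x‖ ≤ hi * ‖x‖ := by
    intro x
    apply le_of_sq_le_sq _ (by positivity)
    rw [mul_pow, norm_sq_l2MulL, Lp.norm_sq_eq_integral, ← integral_const_mul]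
    apply integral_mono (integrable_sq_mul_norm_sq (memLp_bandSymbol hhi volume) x)
      ((Lp.integrable_norm_sq x).const_mul _)
    intro ξ
    have := abs_bandSymbol_le (lo := lo) hhi ξ
    simp only
    gcongr ?_ * _
    exact sq_le_sq' (by linarith [neg_abs_le (bandSymbol E lo hi ξ)]) (le_of_abs_le this)
  have hucont : ContinuousOn u (Ici s) := fun t ht => (hu t ht).continuousWithinAt
  set XF := X ∘L l2FourierL E with hXF
  have hy : ∀ t ∈ Ici s, HasDerivWithinAt (fun t => XF (w t))
      (-K (K (XF (u t))) - (μ / t) • XF (w t)) (Ici s) t := by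
    intro t ht
    -- The derivative is not given in L²; it is recovered from the integral equation, whose
    -- integrand is continuous in L² after the cut-off.
    refine hasDerivWithinAt_Ici_of_eq_integral
      (f := fun t => -K (K (XF (u t))) - (μ / t) • XF (w t)) ?_ ?_ ht
    · have h1 : ContinuousOn (fun τ => μ / τ) (Ici s) :=
        continuousOn_const.div continuousOn_id fun τ hτ => (hs.trans_le hτ).ne'
      have h2 : ContinuousOn (fun τ => XF (w τ)) (Ici s) := XF.continuous.comp_continuousOn hw
      exact ((K.continuous.comp (K.continuous.comp XF.continuous)).neg.comp_continuousOn hucont).sub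
        (h1.smul h2)
    · intro t ht
      have hst : s ≤ t := ht
      have hsub : Icc s t ⊆ Ici s := Icc_subset_Ici_self
      have iu : IntervalIntegrable u volume s t := (hucont.mono hsub).intervalIntegrable_of_Icc hst
      have hw' : ContinuousOn (fun τ => (μ / τ) • w τ) (Icc s t) := by
        refine (continuousOn_const.div continuousOn_id fun τ hτ => ?_).smul (hw.mono hsub)
        exact (hs.trans_le hτ.1).ne'
      have iw : IntervalIntegrable (fun τ => (μ / τ) • w τ) volume s t :=
        hw'.intervalIntegrable_of_Icc hst
      have hlap := Lp.fourier_ae_eq_of_laplacian_eq (laplacian_integral_eq hs hucont hw heq ht)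
      have h1 := l2MulL_freqBand_eq_of_laplacian_symbol (lo := lo) hhi hlap
      have h2 : XF (w t - w s + ∫ τ in s..t, (μ / τ) • w τ) =
          -K (K (XF (∫ τ in s..t, u τ))) := h1
      have iu1 : IntervalIntegrable (fun τ => -K (K (XF (u τ)))) volume s t :=
        (((K.continuous.comp (K.continuous.comp XF.continuous)).neg.comp_continuousOn
          hucont).mono hsub).intervalIntegrable_of_Icc hst
      have iw1 : IntervalIntegrable (fun τ => (μ / τ) • XF (w τ)) volume s t := by
        have := (XF.continuous.comp_continuousOn hw').intervalIntegrable_of_Icc (μ := volume) hst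
        refine this.congr fun τ _ => ?_
        simp
      have hKu : -K (K (XF (∫ τ in s..t, u τ))) = ∫ τ in s..t, -K (K (XF (u τ))) :=
        (ContinuousLinearMap.intervalIntegral_comp_comm (-(K ∘L (K ∘L XF))) iu).symm
      rw [map_add, map_sub, ← ContinuousLinearMap.intervalIntegral_comp_comm _ iw, hKu] at h2
      simp only [map_smul] at h2
      rw [intervalIntegral.integral_sub iu1 iw1, ← h2]
      abel
  refine ⟨_, _, _, _, _, EnergyQuantities.of_hasDerivWithinAt K
    (inner_l2MulL (memLp_bandSymbol hhi volume)) hKb hhi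
    (x := fun t => XF (u t)) (y := fun t => XF (w t))
    (fun t ht => XF.hasFDerivAt.comp_hasDerivWithinAt t (hu t ht)) hy (by simp [hus]), ?_, ?_, ?_⟩
  · intro t hlo
    have e : XF (u t) = X (l2FourierL E (u t)) := rfl
    simp only [e]
    rw [norm_sq_l2MulL, norm_sq_l2MulL, ← integral_const_mul]
    apply integral_mono_ae
      ((integrable_sq_mul_norm_sq (memLp_freqBand_indicator lo hi volume) _).const_mul _)
      (integrable_sq_mul_norm_sq (memLp_bandSymbol hhi volume) _)
    filter_upwards [l2MulL_ae (memLp_freqBand_indicator lo hi volume) (l2FourierL E (u t))]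
      with ξ hξ
    rw [hX, hξ]
    by_cases h : ξ ∈ freqBand E lo hi
    · have := h.1
      simp [bandSymbol, h]
      gcongr
    · simp [h]
  · intro t
    rw [bandEnergy_eq hhi]
    rfl
  · intro t
    have e : XF (w t) = X (l2FourierL E (w t)) := rfl
    simp only [e]
    rw [norm_sq_l2MulL, ← integral_indicator (measurableSet_freqBand lo hi)]
    congr 1 with ξ
    by_cases h : ξ ∈ freqBand E lo hi <;> simp [h]

end BandEnergy

section BandSum

variable {E : Type*} [NormedAddCommGroup E] [InnerProductSpace ℝ E] [FiniteDimensional ℝ E]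
  [MeasurableSpace E] [BorelSpace E]

/-- The weight is bounded on the band, so no H¹ regularity is needed here. -/
theorem integrable_frequency_energy_on_band {lo hi : ℝ} (hhi : 0 ≤ hi)
    (V W : Lp ℂ 2 (volume : Measure E)) :
    IntegrableOn (fun ξ => (2 * Real.pi * ‖ξ‖) ^ 2 * ‖V ξ‖ ^ 2 + ‖W ξ‖ ^ 2)
      (freqBand E lo hi) volume := by
  refine IntegrableOn.add ?_ (Lp.integrable_norm_sq W).integrableOn
  rw [← integrable_indicator_iff (measurableSet_freqBand lo hi)]
  refine (integrable_sq_mul_norm_sq (memLp_bandSymbol (lo := lo) hhi volume) V).congr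
    (ae_of_all _ fun ξ => ?_)
  by_cases h : ξ ∈ freqBand E lo hi <;> simp [bandSymbol, h]

theorem bandEnergy_add {lo mid hi : ℝ} (h₁ : lo ≤ mid) (h₂ : mid ≤ hi) (h₀ : 0 ≤ mid)
    (V W : Lp ℂ 2 (volume : Measure E)) :
    bandEnergy lo hi V W = bandEnergy lo mid V W + bandEnergy mid hi V W := by
  unfold bandEnergy
  rw [← setIntegral_union _ (measurableSet_freqBand mid hi)
    (integrable_frequency_energy_on_band h₀ V W)
    (integrable_frequency_energy_on_band (h₀.trans h₂) V W)]
  · congr 2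
    ext ξ
    simp only [freqBand, mem_ofPred_eq, mem_union, ← Ioc_union_Ioc_eq_Ioc h₁ h₂]
  · rw [Set.disjoint_left]
    intro ξ hξ hξ'
    exact absurd hξ.2 (not_le.2 hξ'.1)

/-- A uniform bound for the energy in frequency bands bounds the whole energy. -/
theorem integral_le_of_bandEnergy_le {V W : Lp ℂ 2 (volume : Measure E)} {c B : ℝ}
    (hintegrable : Integrable fun ξ => (2 * Real.pi * ‖ξ‖) ^ 2 * ‖V ξ‖ ^ 2 + ‖W ξ‖ ^ 2)
    (h : ∀ M, c ≤ M → bandEnergy (-1) M V W ≤ B) :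
    ∫ ξ, (2 * Real.pi * ‖ξ‖) ^ 2 * ‖V ξ‖ ^ 2 + ‖W ξ‖ ^ 2 ≤ B := by
  -- Bands are open on the left; starting at -1 includes the zero frequency.
  have hU : (⋃ k : ℕ, freqBand E (-1) k) = univ := by
    refine eq_univ_of_forall fun ξ => mem_iUnion.2 ?_
    obtain ⟨k, hk⟩ := exists_nat_ge (2 * Real.pi * ‖ξ‖)
    exact ⟨k, lt_of_lt_of_le (by norm_num) (by positivity : (0:ℝ) ≤ 2 * Real.pi * ‖ξ‖), hk⟩
  have hmono : Monotone fun k : ℕ => freqBand E (-1) (k : ℝ) := fun i j hij ξ hξ =>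
    ⟨hξ.1, hξ.2.trans (by exact_mod_cast hij)⟩
  have hlim := tendsto_setIntegral_of_monotone (μ := (volume : Measure E))
    (fun k : ℕ => measurableSet_freqBand (E := E) (-1) (k : ℝ)) hmono hintegrable.integrableOn
  rw [hU, setIntegral_univ] at hlim
  refine le_of_tendsto hlim ?_
  obtain ⟨k₀, hk₀⟩ := exists_nat_ge c
  filter_upwards [eventually_ge_atTop k₀] with k hk
  exact h k (hk₀.trans (by exact_mod_cast hk))

/-- The `L²` mass of the Fourier transform in a frequency band is controlled by the `L¹` norm. -/
theorem setIntegral_freqBand_fourier_le {f : Lp ℂ 2 (volume : Measure E)} (hf : MemLp f 1 volume)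
    {lo hi : ℝ} (hhi : 0 ≤ hi) :
    ∫ ξ in freqBand E lo hi, ‖l2FourierL E f ξ‖ ^ 2 ≤
      volume.real (Metric.closedBall (0 : E) 1) * hi ^ Module.finrank ℝ E *
        (eLpNorm f 1 volume).toReal ^ 2 := by
  have hsub : freqBand E lo hi ⊆ Metric.closedBall (0 : E) hi := by
    intro ξ hξ
    have h1 := hξ.2
    have h2 : 1 ≤ 2 * Real.pi := by linarith [Real.pi_gt_three]
    rw [mem_closedBall_zero_iff]
    nlinarith [norm_nonneg ξ]
  have hfin : volume (freqBand E lo hi) ≠ ⊤ :=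
    ((measure_mono hsub).trans_lt measure_closedBall_lt_top).ne
  calc ∫ ξ in freqBand E lo hi, ‖l2FourierL E f ξ‖ ^ 2
      ≤ ∫ ξ in freqBand E lo hi, (eLpNorm f 1 volume).toReal ^ 2 := by
        refine setIntegral_mono_ae (Lp.integrable_norm_sq _).integrableOn
          (integrableOn_const hfin) ?_
        filter_upwards [Lp.norm_fourier_le_ae hf] with ξ hξ
        rw [l2FourierL_apply]
        gcongr
    _ = volume.real (freqBand E lo hi) * (eLpNorm f 1 volume).toReal ^ 2 := by
        rw [setIntegral_const, smul_eq_mul]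
    _ ≤ volume.real (Metric.closedBall (0 : E) hi) * (eLpNorm f 1 volume).toReal ^ 2 := by
        gcongr
        exact measure_closedBall_lt_top.ne
    _ = _ := by
        rw [Measure.addHaar_real_closedBall' _ _ hhi, mul_comm (hi ^ _)]

theorem setIntegral_freqBand_fourier_le_norm_sq (f : Lp ℂ 2 (volume : Measure E)) (lo hi : ℝ) :
    ∫ ξ in freqBand E lo hi, ‖l2FourierL E f ξ‖ ^ 2 ≤ ‖f‖ ^ 2 := by
  rw [← norm_l2FourierL f, Lp.norm_sq_eq_integral]
  exact setIntegral_le_integral (Lp.integrable_norm_sq _) (ae_of_all _ fun ξ => by positivity)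

end BandSum

/-! ### Plancherel and the sum over dyadic bands -/

namespace IsEnergySolution

variable {n : ℕ} {𝕜 : Type*} [RCLike 𝕜] {μ s : ℝ} {v₁ : EuclideanSpace ℝ (Fin n) → 𝕜}
  {v : ℝ → L2 n 𝕜} {Dv : ℝ → L2 n (EuclideanSpace 𝕜 (Fin n))} {vt : ℝ → L2 n 𝕜}

/-- The norm of the gradient by Plancherel's theorem. -/
theorem integrable_and_norm_gradient_sq (h : IsEnergySolution μ s v₁ v Dv vt) {t : ℝ} (ht : s ≤ t) :
    Integrable (fun ξ => (2 * Real.pi * ‖ξ‖) ^ 2 *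
      ‖l2FourierL (EuclideanSpace ℝ (Fin n)) (toComplexL2 n 𝕜 (v t)) ξ‖ ^ 2) ∧
    ‖Dv t‖ ^ 2 = ∫ ξ, (2 * Real.pi * ‖ξ‖) ^ 2 *
      ‖l2FourierL (EuclideanSpace ℝ (Fin n)) (toComplexL2 n 𝕜 (v t)) ξ‖ ^ 2 := by
  have hae : (fun ξ => ∑ i, ‖l2FourierL (EuclideanSpace ℝ (Fin n))
        (coordComplexL2 n 𝕜 i (Dv t)) ξ‖ ^ 2) =ᵐ[volume] fun ξ => (2 * Real.pi * ‖ξ‖) ^ 2 *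
      ‖l2FourierL (EuclideanSpace ℝ (Fin n)) (toComplexL2 n 𝕜 (v t)) ξ‖ ^ 2 := by
    have : ∀ᵐ ξ, ∀ i, l2FourierL (EuclideanSpace ℝ (Fin n)) (coordComplexL2 n 𝕜 i (Dv t)) ξ =
        (2 * Real.pi * Complex.I) *
          ((inner ℝ ξ (EuclideanSpace.single i (1 : ℝ)) : ℝ) *
            l2FourierL (EuclideanSpace ℝ (Fin n)) (toComplexL2 n 𝕜 (v t)) ξ) :=
      ae_all_iff.2 fun i => Lp.fourier_ae_eq_of_lineDerivOp_eq _
        ((h.weakGradient t ht).lineDerivOp_eq i)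
    filter_upwards [this] with ξ hξ
    simp only [hξ]
    rw [mul_pow, EuclideanSpace.norm_sq_eq, Finset.mul_sum, Finset.sum_mul]
    refine Finset.sum_congr rfl fun i _ => ?_
    simp only [norm_mul, Complex.norm_ofNat, Complex.norm_real, Complex.norm_I, mul_one,
      Real.norm_of_nonneg Real.pi_pos.le]
    rw [EuclideanSpace.inner_single_right]
    simp only [one_mul, conj_trivial, Real.norm_eq_abs, sq_abs, mul_pow]
    ring
  have hintegrable : ∀ i, Integrable (fun ξ => ‖l2FourierL (EuclideanSpace ℝ (Fin n))
        (coordComplexL2 n 𝕜 i (Dv t)) ξ‖ ^ 2) := fun i => Lp.integrable_norm_sq _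
  refine ⟨(integrable_finsetSum _ fun i _ => hintegrable i).congr hae, ?_⟩
  rw [← integral_congr_ae hae, integral_finsetSum _ fun i _ => hintegrable i,
    ← sum_norm_sq_coordComplexL2]
  refine Finset.sum_congr rfl fun i _ => ?_
  rw [← norm_l2FourierL, Lp.norm_sq_eq_integral]

theorem eLpNorm_toComplexL2_init (h : IsEnergySolution μ s v₁ v Dv vt) (p : ENNReal) :
    eLpNorm (toComplexL2 n 𝕜 (vt s)) p volume = eLpNorm v₁ p volume := by
  apply eLpNorm_congr_norm_ae
  filter_upwards [toComplexL2_ae (vt s), h.initial_timeDeriv] with x h1 h2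
  rw [h1, h2, LinearIsometry.norm_map]

theorem energyQuantities (h : IsEnergySolution μ s v₁ v Dv vt) (hs : 0 < s) {lo hi : ℝ}
    (hhi : 0 ≤ hi) :
    ∃ P Q R S D : ℝ → ℝ, EnergyQuantities μ s hi P Q R S D ∧
      (∀ t, 0 ≤ lo → lo ^ 2 * P t ≤ Q t) ∧
      (∀ t, Q t + R t = bandEnergy lo hi
        (l2FourierL (EuclideanSpace ℝ (Fin n)) (toComplexL2 n 𝕜 (v t)))
        (l2FourierL _ (toComplexL2 n 𝕜 (vt t)))) ∧
      (∀ t, R t = ∫ ξ in freqBand (EuclideanSpace ℝ (Fin n)) lo hi,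
        ‖l2FourierL (EuclideanSpace ℝ (Fin n)) (toComplexL2 n 𝕜 (vt t)) ξ‖ ^ 2) :=
  energyQuantities_band hs hhi
    (u := fun t => toComplexL2 n 𝕜 (v t)) (w := fun t => toComplexL2 n 𝕜 (vt t))
    ((toComplexL2 n 𝕜).continuous.comp_continuousOn h.continuousOn_timeDeriv)
    (fun t ht => (toComplexL2 n 𝕜).hasFDerivAt.comp_hasDerivWithinAt t (h.hasDerivWithinAt t ht))
    (by simp [h.initial])
    (fun _ h₁ h₂ _ ht => h.hasDerivAt_realTestSchwartz h₁ h₂ ht)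

/-- The energy estimate in terms of a dyadic decomposition of the intermediate frequencies. -/
theorem exists_energy_le (n : ℕ) (μ : ℝ) : ∃ C : ℝ, 0 < C ∧ ∀ {𝕜 : Type*} [RCLike 𝕜] {s : ℝ}
    {v₁ : EuclideanSpace ℝ (Fin n) → 𝕜} {v : ℝ → L2 n 𝕜}
    {Dv : ℝ → L2 n (EuclideanSpace 𝕜 (Fin n))} {vt : ℝ → L2 n 𝕜},
    0 < s → MemLp v₁ 1 volume → IsEnergySolution μ s v₁ v Dv vt → ∀ t, s ≤ t →
    ∀ J : ℕ, t ≤ s * 2 ^ J → (∀ j < J, s * 2 ^ j ≤ t) →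
      ‖Dv t‖ ^ 2 + ‖vt t‖ ^ 2 ≤
        C * (logFactor μ (t / s) * (s / t) ^ (2 * min μ 1) * t⁻¹ ^ n *
            (∑ j ∈ Finset.range (J + 1), ((2 : ℝ) ^ (n + 2 * min μ 1 - μ)) ^ j) *
              (eLpNorm v₁ 1 volume).toReal ^ 2 +
          (s / t) ^ μ * (eLpNorm v₁ 2 volume).toReal ^ 2) := by
  obtain ⟨C₁, hC₁, low⟩ := EnergyQuantities.energy_le_of_mul_le_two μ
  obtain ⟨C₂, hC₂, middle⟩ := EnergyQuantities.energy_le μ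
  obtain ⟨C₃, hC₃, high⟩ := EnergyQuantities.energy_le_of_one_le μ
  set c₁ : ℝ := volume.real (Metric.closedBall (0 : EuclideanSpace ℝ (Fin n)) 1) with hc₁
  have hc₁0 : 0 ≤ c₁ := measureReal_nonneg
  -- The contributions of the low, middle and high frequencies; 2^n appears because the upper end of
  -- a middle band is twice its lower end.
  refine ⟨C₁ * c₁ + C₂ * c₁ * 2 ^ n + C₃, by positivity, ?_⟩
  intro 𝕜 _ s v₁ v Dv vt hs hv₁ h t hst J hJ hJ'
  have ht : 0 < t := hs.trans_le hst
  have htinv : 0 < t⁻¹ := inv_pos.2 ht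
  set N₁ := (eLpNorm v₁ 1 volume).toReal with hN₁
  set N₂ := (eLpNorm v₁ 2 volume).toReal with hN₂
  set V := l2FourierL (EuclideanSpace ℝ (Fin n)) (toComplexL2 n 𝕜 (v t)) with hV
  set W := l2FourierL (EuclideanSpace ℝ (Fin n)) (toComplexL2 n 𝕜 (vt t)) with hW
  set q : ℝ := (2 : ℝ) ^ (n + 2 * min μ 1 - μ) with hq
  have hq0 : 0 < q := Real.rpow_pos_of_pos two_pos _
  have hmem : MemLp (toComplexL2 n 𝕜 (vt s)) 1 volume :=
    ⟨(Lp.memLp _).1, by rw [h.eLpNorm_toComplexL2_init]; exact hv₁.2⟩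
  have hband₁ : ∀ lo hi : ℝ, 0 ≤ hi → ∫ ξ in freqBand (EuclideanSpace ℝ (Fin n)) lo hi,
      ‖l2FourierL (EuclideanSpace ℝ (Fin n)) (toComplexL2 n 𝕜 (vt s)) ξ‖ ^ 2 ≤
        c₁ * hi ^ n * N₁ ^ 2 := by
    intro lo hi hhi
    have := setIntegral_freqBand_fourier_le hmem (lo := lo) hhi
    rwa [h.eLpNorm_toComplexL2_init, finrank_euclideanSpace_fin] at this
  have hband₂ : ∀ lo hi : ℝ, ∫ ξ in freqBand (EuclideanSpace ℝ (Fin n)) lo hi,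
      ‖l2FourierL (EuclideanSpace ℝ (Fin n)) (toComplexL2 n 𝕜 (vt s)) ξ‖ ^ 2 ≤ N₂ ^ 2 := by
    intro lo hi
    refine (setIntegral_freqBand_fourier_le_norm_sq _ lo hi).trans_eq ?_
    rw [Lp.norm_def, h.eLpNorm_toComplexL2_init]
  have hts : 1 ≤ t / s := (one_le_div hs).2 hst
  have hΛ := one_le_logFactor μ hts
  set A : ℝ := logFactor μ (t / s) * (s / t) ^ (2 * min μ 1) * t⁻¹ ^ n * N₁ ^ 2 with hA
  have hA0 : 0 ≤ A := by positivity
  have hlow : bandEnergy (-1) t⁻¹ V W ≤ C₁ * c₁ * A := by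
    obtain ⟨P, Q, R, S, D, hE, -, hQR, hR⟩ := h.energyQuantities hs (lo := -1) htinv.le
    have h1 := low hs htinv.le hE t hst (by rw [inv_mul_cancel₀ ht.ne']; norm_num)
    rw [hQR, hR] at h1
    refine h1.trans ?_
    calc _ ≤ C₁ * ((s / t) ^ (2 * min μ 1) * logFactor μ (t / s)) * (c₁ * t⁻¹ ^ n * N₁ ^ 2) := by
          gcongr
          exact hband₁ _ _ htinv.le
      _ = _ := by rw [hA]; ring
  have hmid : ∀ j < J, bandEnergy (2 ^ j * t⁻¹) (2 ^ (j + 1) * t⁻¹) V W ≤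
      C₂ * c₁ * 2 ^ n * A * q ^ j := by
    intro j hj
    have h2j : (0 : ℝ) < 2 ^ j := by positivity
    have hhi : (0 : ℝ) ≤ 2 ^ (j + 1) * t⁻¹ := by positivity
    obtain ⟨P, Q, R, S, D, hE, hPQ, hQR, hR⟩ := h.energyQuantities hs (lo := 2 ^ j * t⁻¹) hhi
    -- At T = t/2^j the band satisfies aT = 1 and bT = 2, and T ≥ s since j < J.
    have h1 := middle hs (by positivity) hhi hE (fun t _ => hPQ t (by positivity)) (t / 2 ^ j) t
      ((le_div_iff₀ h2j).2 (hJ' j hj)) (div_le_self ht.le (one_le_pow₀ one_le_two))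
      (le_of_eq (by field_simp; ring)) (le_of_eq (by field_simp))
    rw [hQR, hR] at h1
    refine h1.trans ?_
    have e1 : t / 2 ^ j / t = (2 ^ j : ℝ)⁻¹ := by field_simp
    have e2 : s / (t / 2 ^ j) = s / t * 2 ^ j := by field_simp
    have e3 : q ^ j = ((2 : ℝ) ^ j)⁻¹ ^ μ * ((2 : ℝ) ^ j) ^ (2 * min μ 1) * ((2 : ℝ) ^ j) ^ n := by
      rw [hq, ← Real.rpow_natCast, ← Real.rpow_natCast (2 ^ j) n, ← Real.rpow_natCast 2 j,
        ← Real.rpow_mul two_pos.le, ← Real.rpow_neg two_pos.le, ← Real.rpow_mul two_pos.le,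
        ← Real.rpow_mul two_pos.le, ← Real.rpow_mul two_pos.le, ← Real.rpow_add two_pos,
        ← Real.rpow_add two_pos]
      congr 1
      ring
    calc _ ≤ C₂ * (t / 2 ^ j / t) ^ μ * ((s / (t / 2 ^ j)) ^ (2 * min μ 1) * logFactor μ (t / s)) *
          (c₁ * (2 ^ (j + 1) * t⁻¹) ^ n * N₁ ^ 2) := by
          gcongr
          exact hband₁ _ _ hhi
      _ = _ := by
          rw [e1, e2, e3, Real.mul_rpow (by positivity) h2j.le, hA, pow_succ, mul_pow, mul_pow]
          ring
  have hlowmid : ∀ k ≤ J, bandEnergy (-1) (2 ^ k * t⁻¹) V W ≤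
      C₁ * c₁ * A + ∑ j ∈ Finset.range k, C₂ * c₁ * 2 ^ n * A * q ^ j := by
    intro k
    induction k with
    | zero => intro _; simpa using hlow
    | succ k ih =>
      intro hk
      have hk0 : (0 : ℝ) ≤ 2 ^ k * t⁻¹ := by positivity
      rw [bandEnergy_add (mid := 2 ^ k * t⁻¹) (by linarith) (by gcongr <;> simp) hk0,
        Finset.sum_range_succ]
      have h1 := ih (Nat.le_of_succ_le hk)
      have h2 := hmid k hk
      linarith
  have hhigh : ∀ M, 2 ^ J * t⁻¹ ≤ M → bandEnergy (2 ^ J * t⁻¹) M V W ≤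
      C₃ * ((s / t) ^ μ * N₂ ^ 2) := by
    intro M hM
    have hlo : (0 : ℝ) < 2 ^ J * t⁻¹ := by positivity
    have hhi : (0 : ℝ) ≤ M := hlo.le.trans hM
    obtain ⟨P, Q, R, S, D, hE, hPQ, hQR, hR⟩ := h.energyQuantities hs (lo := 2 ^ J * t⁻¹) hhi
    -- Since 2^J/t ≥ 1/s, the band oscillates from the initial time on, where Q vanishes.
    have h1 := high hs hlo hE (fun t _ => hPQ t hlo.le) s t le_rfl hst (by
      rw [← div_eq_mul_inv, div_mul_eq_mul_div, one_le_div ht]; linarith)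
    rw [hE.Q_init, zero_add, hQR, hR] at h1
    refine h1.trans ?_
    rw [← mul_assoc]
    gcongr
    exact hband₂ _ _
  obtain ⟨hintegrable, hDv⟩ := h.integrable_and_norm_gradient_sq hst
  have hvt : ‖vt t‖ ^ 2 = ∫ ξ, ‖W ξ‖ ^ 2 := by
    rw [← norm_toComplexL2, ← norm_l2FourierL, Lp.norm_sq_eq_integral]
  rw [hDv, hvt, ← integral_add hintegrable (Lp.integrable_norm_sq W)]
  refine integral_le_of_bandEnergy_le (c := 2 ^ J * t⁻¹)
    (hintegrable.add (Lp.integrable_norm_sq W)) fun M hM => ?_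
  have hlo : (0 : ℝ) < 2 ^ J * t⁻¹ := by positivity
  rw [bandEnergy_add (mid := 2 ^ J * t⁻¹) (by linarith) hM hlo.le]
  have h1 := hlowmid J le_rfl
  have h2 := hhigh M hM
  rw [← Finset.mul_sum] at h1
  set G := ∑ j ∈ Finset.range (J + 1), q ^ j with hG
  have hle : ∑ j ∈ Finset.range J, q ^ j ≤ G := by
    rw [hG, Finset.sum_range_succ]
    have := pow_pos hq0 J
    linarith
  have hone : 1 ≤ G := by
    rw [hG, Finset.sum_range_succ']
    have : 0 ≤ ∑ j ∈ Finset.range J, q ^ (j + 1) := Finset.sum_nonneg fun j _ => by positivity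
    simpa using this
  have hB0 : 0 ≤ (s / t) ^ μ * N₂ ^ 2 := by positivity
  calc bandEnergy (-1) (2 ^ J * t⁻¹) V W + bandEnergy (2 ^ J * t⁻¹) M V W
      ≤ C₁ * c₁ * A * 1 + C₂ * c₁ * 2 ^ n * A * ∑ j ∈ Finset.range J, q ^ j +
        C₃ * ((s / t) ^ μ * N₂ ^ 2) := by linarith
    _ ≤ C₁ * c₁ * A * G + C₂ * c₁ * 2 ^ n * A * G + C₃ * ((s / t) ^ μ * N₂ ^ 2) := by gcongr
    -- The missing nonnegative cross terms are added so that a single constant can be factored out.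
    _ ≤ (C₁ * c₁ * A * G + C₂ * c₁ * 2 ^ n * A * G + C₃ * ((s / t) ^ μ * N₂ ^ 2)) +
        (C₃ * (A * G) + (C₁ * c₁ + C₂ * c₁ * 2 ^ n) * ((s / t) ^ μ * N₂ ^ 2)) := by
        have : 0 ≤ G := zero_le_one.trans hone
        exact le_add_of_nonneg_right (by positivity)
    _ = _ := by rw [hA]; ring

end IsEnergySolution

end

/-! ### Geometric sums and powers of s and t -/

theorem exists_two_pow_bracket {x : ℝ} (hx : 1 ≤ x) :
    ∃ k : ℕ, x ≤ 2 ^ (k + 1) ∧ 2 ^ k ≤ x := by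
  obtain ⟨k, h₁, h₂⟩ := exists_nat_pow_near hx one_lt_two
  exact ⟨k, h₂.le, h₁⟩

theorem geom_sum_le_of_neg {e : ℝ} (he : e < 0) (m : ℕ) :
    ∑ j ∈ Finset.range m, ((2 : ℝ) ^ e) ^ j ≤ (1 - 2 ^ e)⁻¹ := by
  have h0 : (0 : ℝ) ≤ 2 ^ e := by positivity
  have h1 : (2 : ℝ) ^ e < 1 := Real.rpow_lt_one_of_one_lt_of_neg one_lt_two he
  rw [← tsum_geometric_of_lt_one h0 h1]
  exact (summable_geometric_of_lt_one h0 h1).sum_le_tsum _ fun j _ => by positivity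

/-- The last terms dominate; 4^e comes from 2^(k+2) = 4 · 2^k. -/
theorem geom_sum_le_of_pos {e x : ℝ} (he : 0 < e) {k : ℕ} (hk : 2 ^ k ≤ x) :
    ∑ j ∈ Finset.range (k + 1 + 1), ((2 : ℝ) ^ e) ^ j ≤ 4 ^ e / (2 ^ e - 1) * x ^ e := by
  have h1 : (1 : ℝ) < 2 ^ e := Real.one_lt_rpow one_lt_two he
  rw [geom_sum_eq h1.ne', div_mul_eq_mul_div]
  have h2 : (0 : ℝ) < 2 ^ e - 1 := by linarith
  gcongr
  calc ((2 : ℝ) ^ e) ^ (k + 1 + 1) - 1 ≤ ((2 : ℝ) ^ e) ^ (k + 1 + 1) := by linarith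
    _ = 4 ^ e * (2 ^ k) ^ e := by
        rw [← Real.mul_rpow (by norm_num) (by positivity), ← Real.rpow_natCast,
          ← Real.rpow_mul two_pos.le, mul_comm, Real.rpow_mul two_pos.le, Real.rpow_natCast]
        congr 1
        ring
    _ ≤ 4 ^ e * x ^ e := by gcongr

/-- The number of dyadic terms grows at most logarithmically, because log 2 ≥ 1/2. -/
theorem natCast_add_two_le_of_two_pow_le {x : ℝ} {k : ℕ} (hk : 2 ^ k ≤ x) :
    (k + 2 : ℝ) ≤ 2 * (1 + Real.log x) := by
  have h1 : (k : ℝ) * Real.log 2 ≤ Real.log x := by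
    rw [← Real.log_pow]
    exact Real.log_le_log (by positivity) hk
  have h2 := Real.log_two_gt_d9
  have : (k : ℝ) * (1 / 2) ≤ k * Real.log 2 := by gcongr; linarith
  linarith

theorem sqrt_le_mul_add {X C K x y a b N₁ N₂ : ℝ} (hC : 0 ≤ C) (hK : 0 ≤ K) (ha : 0 ≤ a) (hb : 0 ≤ b)
    (hN₁ : 0 ≤ N₁) (hN₂ : 0 ≤ N₂) (h : X ≤ C * (x * N₁ ^ 2 + y * N₂ ^ 2))
    (hx : x ≤ K * a ^ 2) (hy : y ≤ K * b ^ 2) :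
    Real.sqrt X ≤ Real.sqrt (C * K) * (a * N₁ + b * N₂) := by
  apply Real.sqrt_le_iff.2 ⟨by positivity, ?_⟩
  rw [mul_pow, Real.sq_sqrt (by positivity)]
  calc X ≤ C * (x * N₁ ^ 2 + y * N₂ ^ 2) := h
    _ ≤ C * (K * a ^ 2 * N₁ ^ 2 + K * b ^ 2 * N₂ ^ 2) := by gcongr
    _ = C * K * (a ^ 2 * N₁ ^ 2 + b ^ 2 * N₂ ^ 2) := by ring
    _ ≤ C * K * (a * N₁ + b * N₂) ^ 2 := by
        have : 0 ≤ a * N₁ * (b * N₂) := by positivity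
        gcongr
        nlinarith

/-- With s = exp σ and t = exp τ, this is a linear identity between exponents. It evaluates the
geometric sum at its largest term, where the dependence on ν disappears. -/
theorem rpow_weight_identity {s t : ℝ} (hs : 0 < s) (ht : 0 < t) (n : ℕ) (ν μ : ℝ) :
    (s / t) ^ ν * t⁻¹ ^ n * (t / s) ^ (n + ν - μ) =
      (t ^ (-μ / 2) * s ^ ((μ - n) / 2)) ^ 2 := by
  obtain ⟨σ, rfl⟩ : ∃ σ, Real.exp σ = s := ⟨_, Real.exp_log hs⟩
  obtain ⟨τ, rfl⟩ : ∃ τ, Real.exp τ = t := ⟨_, Real.exp_log ht⟩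
  simp only [← Real.exp_sub, ← Real.exp_mul, ← Real.exp_neg, ← Real.exp_nat_mul, ← Real.exp_add]
  congr 1
  push_cast
  ring

theorem div_rpow_eq_sq {s t : ℝ} (hs : 0 < s) (ht : 0 < t) (μ : ℝ) :
    (s / t) ^ μ = (t ^ (-μ / 2) * s ^ (μ / 2)) ^ 2 := by
  obtain ⟨σ, rfl⟩ : ∃ σ, Real.exp σ = s := ⟨_, Real.exp_log hs⟩
  obtain ⟨τ, rfl⟩ : ∃ τ, Real.exp τ = t := ⟨_, Real.exp_log ht⟩
  simp only [← Real.exp_sub, ← Real.exp_mul, ← Real.exp_nat_mul, ← Real.exp_add]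
  congr 1
  push_cast
  ring

theorem div_sq_mul_inv_pow_eq_sq {s t : ℝ} (hs : 0 < s) (ht : 0 < t) (n : ℕ) :
    (s / t) ^ (2 : ℝ) * t⁻¹ ^ n = (s * t ^ (-(n : ℝ) / 2 - 1)) ^ 2 := by
  obtain ⟨σ, rfl⟩ : ∃ σ, Real.exp σ = s := ⟨_, Real.exp_log hs⟩
  obtain ⟨τ, rfl⟩ : ∃ τ, Real.exp τ = t := ⟨_, Real.exp_log ht⟩
  simp only [← Real.exp_sub, ← Real.exp_mul, ← Real.exp_neg, ← Real.exp_nat_mul, ← Real.exp_add]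
  congr 1
  push_cast
  ring

theorem div_rpow_add_two_eq_sq {s t : ℝ} (hs : 0 < s) (ht : 0 < t) (n : ℕ) :
    (s / t) ^ ((n : ℝ) + 2) = (s * t ^ (-(n : ℝ) / 2 - 1) * s ^ ((n : ℝ) / 2)) ^ 2 := by
  obtain ⟨σ, rfl⟩ : ∃ σ, Real.exp σ = s := ⟨_, Real.exp_log hs⟩
  obtain ⟨τ, rfl⟩ : ∃ τ, Real.exp τ = t := ⟨_, Real.exp_log ht⟩
  simp only [← Real.exp_sub, ← Real.exp_mul, ← Real.exp_nat_mul, ← Real.exp_add]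
  congr 1
  push_cast
  ring

/-! ### The three ranges of μ -/

namespace IsEnergySolution

/-- From a pointwise comparison of the coefficients to an estimate of the energy norm. -/
theorem exists_sqrt_energy_le (n : ℕ) (μ K : ℝ) (hK : 0 < K) (a b : ℝ → ℝ → ℝ)
    (ha : ∀ s t, 0 < s → s ≤ t → 0 ≤ a s t) (hb : ∀ s t, 0 < s → s ≤ t → 0 ≤ b s t)
    (haK : ∀ s t, 0 < s → s ≤ t → ∀ k : ℕ, 2 ^ k ≤ t / s →
      logFactor μ (t / s) * (s / t) ^ (2 * min μ 1) * t⁻¹ ^ n *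
        (∑ j ∈ Finset.range (k + 1 + 1), ((2 : ℝ) ^ (n + 2 * min μ 1 - μ)) ^ j) ≤ K * a s t ^ 2)
    (hbK : ∀ s t, 0 < s → s ≤ t → (s / t) ^ μ ≤ K * b s t ^ 2) :
    ∃ C : ℝ, 0 < C ∧ ∀ {𝕜 : Type*} [RCLike 𝕜] {s : ℝ}
      {v₁ : EuclideanSpace ℝ (Fin n) → 𝕜} {v : ℝ → L2 n 𝕜}
      {Dv : ℝ → L2 n (EuclideanSpace 𝕜 (Fin n))} {vt : ℝ → L2 n 𝕜},
      0 < s → MemLp v₁ 1 volume → IsEnergySolution μ s v₁ v Dv vt → ∀ t, s ≤ t →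
        Real.sqrt (‖Dv t‖ ^ 2 + ‖vt t‖ ^ 2) ≤
          C * (a s t * (eLpNorm v₁ 1 volume).toReal + b s t * (eLpNorm v₁ 2 volume).toReal) := by
  obtain ⟨C, hC, h⟩ := exists_energy_le n μ
  refine ⟨Real.sqrt (C * K), by positivity, ?_⟩
  intro 𝕜 _ s v₁ v Dv vt hs hv₁ hsol t hst
  obtain ⟨k, hk₁, hk₂⟩ := exists_two_pow_bracket ((one_le_div hs).2 hst)
  have hE := h hs hv₁ hsol t hst (k + 1) (by rw [div_le_iff₀ hs] at hk₁; linarith) (by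
    intro j hj
    rw [le_div_iff₀ hs] at hk₂
    have : (2 : ℝ) ^ j ≤ 2 ^ k := pow_le_pow_right₀ one_le_two (Nat.lt_succ_iff.1 hj)
    nlinarith)
  exact sqrt_le_mul_add hC.le hK.le (ha s t hs hst) (hb s t hs hst) ENNReal.toReal_nonneg
    ENNReal.toReal_nonneg hE (haK s t hs hst k hk₂) (hbK s t hs hst)

/-- The energy estimate for `-n < μ < n + 2`. -/
theorem exists_sqrt_energy_le_of_lt (n : ℕ) (μ : ℝ) (hμn : -(n : ℝ) < μ) (hμ : μ < n + 2) :
    ∃ C : ℝ, 0 < C ∧ ∀ {𝕜 : Type*} [RCLike 𝕜] {s : ℝ}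
      {v₁ : EuclideanSpace ℝ (Fin n) → 𝕜} {v : ℝ → L2 n 𝕜}
      {Dv : ℝ → L2 n (EuclideanSpace 𝕜 (Fin n))} {vt : ℝ → L2 n 𝕜},
      0 < s → MemLp v₁ 1 volume → IsEnergySolution μ s v₁ v Dv vt → ∀ t, s ≤ t →
        Real.sqrt (‖Dv t‖ ^ 2 + ‖vt t‖ ^ 2) ≤
          C * (t ^ (-μ / 2) * s ^ ((μ - n) / 2) * (if μ = 1 then 1 + Real.log (t / s) else 1) *
              (eLpNorm v₁ 1 volume).toReal +
            t ^ (-μ / 2) * s ^ (μ / 2) * (eLpNorm v₁ 2 volume).toReal) := by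
  -- The exponent is n + μ for μ ≤ 1 and n + 2 - μ for μ ≥ 1, which is where both bounds on μ enter.
  have he : (0 : ℝ) < n + 2 * min μ 1 - μ := by
    rcases le_total μ 1 with h | h
    · rw [min_eq_left h]; linarith
    · rw [min_eq_right h]; linarith
  have hq : (1 : ℝ) < 2 ^ ((n : ℝ) + 2 * min μ 1 - μ) := Real.one_lt_rpow one_lt_two he
  set c : ℝ := 4 ^ ((n : ℝ) + 2 * min μ 1 - μ) / (2 ^ ((n : ℝ) + 2 * min μ 1 - μ) - 1) with hc
  have hc0 : 0 < c := div_pos (by positivity) (by linarith)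
  -- c + 1 dominates both c, needed for the L¹ weight, and 1, needed for the L² weight.
  refine exists_sqrt_energy_le n μ (c + 1) (by positivity)
    (fun s t => t ^ (-μ / 2) * s ^ ((μ - n) / 2) * (if μ = 1 then 1 + Real.log (t / s) else 1))
    (fun s t => t ^ (-μ / 2) * s ^ (μ / 2)) ?_ ?_ ?_ ?_
  · intro s t hs hst
    have := Real.log_nonneg ((one_le_div hs).2 hst)
    have := hs.trans_le hst
    split_ifs <;> positivity
  · intro s t hs hst
    have := hs.trans_le hst
    positivity
  · intro s t hs hst k hk
    have ht := hs.trans_le hst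
    have hl := one_le_logFactor μ ((one_le_div hs).2 hst)
    have hl2 : logFactor μ (t / s) = (if μ = 1 then 1 + Real.log (t / s) else 1) ^ 2 := by
      unfold logFactor; split_ifs <;> simp
    calc _ ≤ logFactor μ (t / s) * (s / t) ^ (2 * min μ 1) * t⁻¹ ^ n *
          (c * (t / s) ^ ((n : ℝ) + 2 * min μ 1 - μ)) := by
          gcongr
          exact geom_sum_le_of_pos he hk
      _ = c * (logFactor μ (t / s) * ((s / t) ^ (2 * min μ 1) * t⁻¹ ^ n *
          (t / s) ^ ((n : ℝ) + 2 * min μ 1 - μ))) := by ring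
      _ = c * (t ^ (-μ / 2) * s ^ ((μ - n) / 2) *
            (if μ = 1 then 1 + Real.log (t / s) else 1)) ^ 2 := by
          rw [rpow_weight_identity hs ht, hl2]
          ring
      _ ≤ _ := by gcongr; linarith
  · intro s t hs hst
    rw [div_rpow_eq_sq hs (hs.trans_le hst)]
    exact le_mul_of_one_le_left (by positivity) (by linarith)

/-- The energy estimate for `μ = n + 2`. -/
theorem exists_sqrt_energy_le_of_eq (n : ℕ) (hn : 1 ≤ n) :
    ∃ C : ℝ, 0 < C ∧ ∀ {𝕜 : Type*} [RCLike 𝕜] {s : ℝ}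
      {v₁ : EuclideanSpace ℝ (Fin n) → 𝕜} {v : ℝ → L2 n 𝕜}
      {Dv : ℝ → L2 n (EuclideanSpace 𝕜 (Fin n))} {vt : ℝ → L2 n 𝕜},
      0 < s → MemLp v₁ 1 volume → IsEnergySolution ((n : ℝ) + 2) s v₁ v Dv vt → ∀ t, s ≤ t →
        Real.sqrt (‖Dv t‖ ^ 2 + ‖vt t‖ ^ 2) ≤
          C * (s * t ^ (-(n : ℝ) / 2 - 1) * (1 + Real.log (t / s)) * (eLpNorm v₁ 1 volume).toReal +
            s * t ^ (-(n : ℝ) / 2 - 1) * (1 + Real.log (t / s)) * s ^ ((n : ℝ) / 2) *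
              (eLpNorm v₁ 2 volume).toReal) := by
  have hn0 : (1 : ℝ) ≤ n := by exact_mod_cast hn
  have hmin : min ((n : ℝ) + 2) 1 = 1 := min_eq_right (by linarith)
  have hΛ : ∀ x, logFactor ((n : ℝ) + 2) x = 1 := fun x => if_neg (by linarith)
  refine exists_sqrt_energy_le n (n + 2) 2 two_pos
    (fun s t => s * t ^ (-(n : ℝ) / 2 - 1) * (1 + Real.log (t / s)))
    (fun s t => s * t ^ (-(n : ℝ) / 2 - 1) * (1 + Real.log (t / s)) * s ^ ((n : ℝ) / 2)) ?_ ?_ ?_ ?_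
  · intro s t hs hst
    have := Real.log_nonneg ((one_le_div hs).2 hst)
    have := hs.trans_le hst
    positivity
  · intro s t hs hst
    have := Real.log_nonneg ((one_le_div hs).2 hst)
    have := hs.trans_le hst
    positivity
  · intro s t hs hst k hk
    have ht := hs.trans_le hst
    have hlog := Real.log_nonneg ((one_le_div hs).2 hst)
    have hk2 := natCast_add_two_le_of_two_pow_le hk
    rw [hmin, hΛ, mul_one, one_mul, div_sq_mul_inv_pow_eq_sq hs ht, sub_self, Real.rpow_zero]
    simp only [one_pow, Finset.sum_const, Finset.card_range, nsmul_eq_mul, mul_one]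
    push_cast
    -- The sum gives one power of 1 + log(t/s) in the squared energy; it is bounded by the square of
    -- that factor, as the claimed estimate allows.
    calc (s * t ^ (-(n : ℝ) / 2 - 1)) ^ 2 * ((k : ℝ) + 1 + 1)
        ≤ (s * t ^ (-(n : ℝ) / 2 - 1)) ^ 2 * (2 * (1 + Real.log (t / s)) ^ 2) := by
          gcongr
          nlinarith
      _ = _ := by ring
  · intro s t hs hst
    have ht := hs.trans_le hst
    have hlog := Real.log_nonneg ((one_le_div hs).2 hst)
    rw [div_rpow_add_two_eq_sq hs ht]
    have h1 : 1 ≤ 2 * (1 + Real.log (t / s)) ^ 2 := by nlinarith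
    calc _ ≤ 2 * (1 + Real.log (t / s)) ^ 2 *
          (s * t ^ (-(n : ℝ) / 2 - 1) * s ^ ((n : ℝ) / 2)) ^ 2 :=
          le_mul_of_one_le_left (by positivity) h1
      _ = _ := by ring

/-- The energy estimate for `μ > n + 2`. -/
theorem exists_sqrt_energy_le_of_gt (n : ℕ) (μ : ℝ) (hn : 1 ≤ n) (hμ : (n : ℝ) + 2 < μ) :
    ∃ C : ℝ, 0 < C ∧ ∀ {𝕜 : Type*} [RCLike 𝕜] {s : ℝ}
      {v₁ : EuclideanSpace ℝ (Fin n) → 𝕜} {v : ℝ → L2 n 𝕜}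
      {Dv : ℝ → L2 n (EuclideanSpace 𝕜 (Fin n))} {vt : ℝ → L2 n 𝕜},
      0 < s → MemLp v₁ 1 volume → IsEnergySolution μ s v₁ v Dv vt → ∀ t, s ≤ t →
        Real.sqrt (‖Dv t‖ ^ 2 + ‖vt t‖ ^ 2) ≤
          C * (s * t ^ (-(n : ℝ) / 2 - 1) * (eLpNorm v₁ 1 volume).toReal +
            s * t ^ (-(n : ℝ) / 2 - 1) * s ^ ((n : ℝ) / 2) * (eLpNorm v₁ 2 volume).toReal) := by
  have hn0 : (1 : ℝ) ≤ n := by exact_mod_cast hn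
  have hmin : min μ 1 = 1 := min_eq_right (by linarith)
  have hΛ : ∀ x, logFactor μ x = 1 := fun x => if_neg (by linarith)
  have he : (n : ℝ) + 2 - μ < 0 := by linarith
  have hq : (2 : ℝ) ^ ((n : ℝ) + 2 - μ) < 1 := Real.rpow_lt_one_of_one_lt_of_neg one_lt_two he
  set c : ℝ := (1 - 2 ^ ((n : ℝ) + 2 - μ))⁻¹ with hc
  have hc0 : 0 < c := inv_pos.2 (by linarith)
  refine exists_sqrt_energy_le n μ (c + 1) (by positivity)
    (fun s t => s * t ^ (-(n : ℝ) / 2 - 1))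
    (fun s t => s * t ^ (-(n : ℝ) / 2 - 1) * s ^ ((n : ℝ) / 2)) ?_ ?_ ?_ ?_
  · intro s t hs hst
    have := hs.trans_le hst
    positivity
  · intro s t hs hst
    have := hs.trans_le hst
    positivity
  · intro s t hs hst k hk
    have ht := hs.trans_le hst
    rw [hmin, hΛ, mul_one, one_mul, div_sq_mul_inv_pow_eq_sq hs ht, mul_comm]
    gcongr
    exact (geom_sum_le_of_neg he _).trans (by linarith)
  · intro s t hs hst
    have ht := hs.trans_le hst
    -- The high frequencies decay faster than required, as s/t ≤ 1 and μ > n + 2.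
    calc (s / t) ^ μ ≤ (s / t) ^ ((n : ℝ) + 2) :=
          Real.rpow_le_rpow_of_exponent_ge (by positivity) ((div_le_one ht).2 hst) hμ.le
      _ = (s * t ^ (-(n : ℝ) / 2 - 1) * s ^ ((n : ℝ) / 2)) ^ 2 := div_rpow_add_two_eq_sq hs ht n
      _ ≤ _ := le_mul_of_one_le_left (by positivity) (by linarith)

end IsEnergySolution

theorem proposition2p4 {𝕜 : Type*} [RCLike 𝕜] (n : ℕ) (hn : 1 ≤ n) (μ : ℝ) :
    ∃ C : ℝ, 0 < C ∧
      ∀ s : ℝ, 0 < s →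
      ∀ v₁ : EuclideanSpace ℝ (Fin n) → 𝕜, MemLp v₁ 1 volume → MemLp v₁ 2 volume →
      ∀ (v : ℝ → L2 n 𝕜) (Dv : ℝ → L2 n (EuclideanSpace 𝕜 (Fin n))) (vt : ℝ → L2 n 𝕜),
      IsEnergySolution μ s v₁ v Dv vt →
      ∀ t : ℝ, s ≤ t →
        ((n : ℝ) + 2 < μ →
          Real.sqrt (‖Dv t‖ ^ 2 + ‖vt t‖ ^ 2) ≤
            C * s * t ^ (-(n : ℝ) / 2 - 1) *
              ((eLpNorm v₁ 1 volume).toReal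
                + s ^ ((n : ℝ) / 2) * (eLpNorm v₁ 2 volume).toReal)) ∧
        (μ = (n : ℝ) + 2 →
          Real.sqrt (‖Dv t‖ ^ 2 + ‖vt t‖ ^ 2) ≤
            C * s * t ^ (-μ / 2) * (1 + Real.log (t / s)) *
              ((eLpNorm v₁ 1 volume).toReal
                + s ^ ((n : ℝ) / 2) * (eLpNorm v₁ 2 volume).toReal)) ∧
        (-(n : ℝ) < μ → μ < (n : ℝ) + 2 → μ ≠ 1 →
          Real.sqrt (‖Dv t‖ ^ 2 + ‖vt t‖ ^ 2) ≤
            C * t ^ (-μ / 2) *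
              (s ^ ((μ - (n : ℝ)) / 2) * (eLpNorm v₁ 1 volume).toReal
                + s ^ (μ / 2) * (eLpNorm v₁ 2 volume).toReal)) ∧
        (μ = 1 →
          Real.sqrt (‖Dv t‖ ^ 2 + ‖vt t‖ ^ 2) ≤
            C * t ^ (-(1 : ℝ) / 2) *
              (s ^ (-((n : ℝ) - 1) / 2) * (1 + Real.log (t / s)) * (eLpNorm v₁ 1 volume).toReal
                + s ^ (μ / 2) * (eLpNorm v₁ 2 volume).toReal)) := by
  have hn0 : (1 : ℝ) ≤ n := by exact_mod_cast hn
  rcases lt_trichotomy μ ((n : ℝ) + 2) with hμ | hμ | hμ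
  · rcases le_or_gt μ (-n) with hμn | hμn
    -- For μ ≤ -n none of the four cases applies, so any constant will do.
    · exact ⟨1, one_pos, fun s hs v₁ _ _ v Dv vt _ t hst =>
        ⟨fun h => absurd h hμ.not_gt, fun h => absurd h hμ.ne, fun h => absurd h hμn.not_gt,
          fun h => by linarith⟩⟩
    · obtain ⟨C, hC, h⟩ := IsEnergySolution.exists_sqrt_energy_le_of_lt n μ hμn hμ
      refine ⟨C, hC, fun s hs v₁ hv₁ _ v Dv vt hsol t hst =>
        ⟨fun h => absurd h hμ.not_gt, fun h => absurd h hμ.ne, fun _ _ h1 => ?_, fun h1 => ?_⟩⟩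
      · refine (h hs hv₁ hsol t hst).trans_eq ?_
        rw [if_neg h1]
        ring
      · refine (h hs hv₁ hsol t hst).trans_eq ?_
        rw [if_pos h1]
        subst h1
        rw [show -((n : ℝ) - 1) / 2 = (1 - n) / 2 by ring]
        ring
  · obtain ⟨C, hC, h⟩ := IsEnergySolution.exists_sqrt_energy_le_of_eq n hn
    subst hμ
    refine ⟨C, hC, fun s hs v₁ hv₁ _ v Dv vt hsol t hst =>
        ⟨fun h => absurd h (lt_irrefl _), fun _ => ?_, fun _ h => absurd h (lt_irrefl _),
          fun h => by linarith⟩⟩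
    refine (h hs hv₁ hsol t hst).trans_eq ?_
    rw [show -((n : ℝ) + 2) / 2 = -(n : ℝ) / 2 - 1 by ring]
    ring
  · obtain ⟨C, hC, h⟩ := IsEnergySolution.exists_sqrt_energy_le_of_gt n μ hn hμ
    refine ⟨C, hC, fun s hs v₁ hv₁ _ v Dv vt hsol t hst =>
        ⟨fun _ => ?_, fun h => absurd h hμ.ne', fun _ h => absurd h hμ.not_gt,
          fun h => by linarith⟩⟩
    refine (h hs hv₁ hsol t hst).trans_eq ?_
    ring
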